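/- Let $r$ be the unique $C^1[1,2)$ solution, with $r>\pi/2$ on $(1,2)$, of $\dot r = 2^{1/2}\pi^{-1/2}\, r^2\,(r-\tfrac{\pi}{2})^{1/2}$, $r(1)=\tfrac{\pi}{2}$, extended to $(0,2)$ by $r(t)=r(2-t)$. Put $\ell=1/r$ on $(0,2)$ and $$\rho_{\lim}(t,x) = -\tfrac{1}{2\pi}\, r(t)\Big(1-\frac{x^2}{\ell(t)^2}\Big)_+ ,\qquad (t,x)\in(0,2)\times\mathbb{R}.$$ For $s\le t$ in $[0,2]$, let $H^1((s,y)\to(t,x))$ be the set of absolutely continuous paths $\gamma:[s,t]\to\mathbb{R}$ with $\gamma(s)=y$, $\gamma(t)=x$ and $\int_s^t\dot\gamma^2\,du<\infty$. Define $$h_{\lim}(t,x) = -\inf\Big\{\int_0^t \Big(\tfrac12\dot\gamma(u)^2-\rho_{\lim}(u,\gamma(u))\Big)\,du \;:\; \gamma\in H^1((0,0)\to(t,x))\Big\},\qquad \inf\emptyset:=\infty .$$ A path that attains this infimum is called a geodesic. For $0\le s<t\le 2$, the points $(s,y)$ and $(t,x)$ are connected by a geodesic, written $(s,y)\xrightarrow{\mathrm{geod.}}(t,x)$,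 if some geodesic, from $(0,0)$ to some point with time coordinate in $[t,2]$, passes through both points. For $\lambda>0$, $s<t$ in $[0,2]$, $x,y\in\mathbb{R}$ and $\rho\in L^2([0,2]\times\mathbb{R})$, let $$\mathrm{FK}_\lambda[\rho](s,y;t,x) = \mathbb{E}\Big[\exp\Big(\int_s^t\lambda\,\rho(u,W_\lambda(u))\,du\Big)\Big],$$ where $W_\lambda$ is the Brownian bridge $$W_\lambda(u)=\lambda^{-1/2}\Big(B(t-u)-\tfrac{t-u}{t-s}B(t-s)\Big)+\tfrac{(u-s)x+(t-u)y}{t-s},\qquad u\in[s,t],$$ and $B$ is a standard Brownian motion. **Proposition.** For any family $\{\rho^{(\lambda)}\}_{\lambda>0}\subset L^2([0,2]\times\mathbb{R})$ with $\rho^{(\lambda)}\to\rho_{\lim}$ in $L^2$ as $\lambda\to\infty$, $$\liminf_{\lambda\to\infty}\ \inf\Big\{\frac1\lambda\log \mathrm{FK}_\lambda[\rho^{(\lambda)}](s,y;t,x)-\Big(h_{\lim}(t,x)-h_{\lim}(s,y)+\frac{(y-x)^2}{2(t-s)}\Big)\Big\}\ \ge\ 0,$$ where the infimum is over all $(s,y)\xrightarrow{\mathrm{geod.}}(t,x)$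 with $s<t$. -/

import Mathlib

open MeasureTheory ProbabilityTheory Set Filter Topology
open scoped ENNReal NNReal

namespace LowerTail

noncomputable section

/-! ### The profile `r` -/

/-- `r` is a `C¹[1,2)` solution, larger than `π/2` on `(1,2)`, of
`ṙ = 2^{1/2} π^{-1/2} r² (r - π/2)^{1/2}` with `r(1) = π/2`. -/
structure IsProfile (r : ℝ → ℝ) : Prop where
  contDiffOn : ContDiffOn ℝ 1 r (Ico 1 2)
  ode : ∀ t ∈ Ico (1 : ℝ) 2,
    HasDerivWithinAt r
      (√2 * (√Real.pi)⁻¹ * r t ^ 2 * √(r t - Real.pi / 2)) (Ico 1 2) t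
  init : r 1 = Real.pi / 2
  gt : ∀ t ∈ Ioo (1 : ℝ) 2, Real.pi / 2 < r t

/-- Elapsed time `t - 1` as a function of `v = (2 r / π - 1)^{1/2}`; an auxiliary function used
only to show that the profile exists and is unique. -/
def elapsed (v : ℝ) : ℝ := (2 * Real.arctan v + 2 * v / (1 + v ^ 2)) / Real.pi

lemma elapsed_hasStrictDerivAt (v : ℝ) :
    HasStrictDerivAt elapsed (4 / (Real.pi * (1 + v ^ 2) ^ 2)) v := by
  have hv : (1 + v ^ 2) ≠ 0 := by positivity
  have h1 := (Real.hasStrictDerivAt_arctan v).const_mul 2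
  have h2 : HasStrictDerivAt (fun v : ℝ => 1 + v ^ 2) (2 * v) v := by
    simpa using ((hasStrictDerivAt_id v).pow 2).const_add 1
  have h3 := ((hasStrictDerivAt_id v).const_mul 2).div h2 hv
  have h4 := (h1.add h3).div_const Real.pi
  have hpi := Real.pi_ne_zero
  refine h4.congr_deriv ?_
  simp only [id]
  field_simp
  ring

lemma elapsed_strictMono : StrictMono elapsed := by
  apply strictMono_of_deriv_pos
  intro v
  rw [(elapsed_hasStrictDerivAt v).hasDerivAt.deriv]
  have := Real.pi_pos
  positivity

lemma elapsed_zero : elapsed 0 = 0 := by simp [elapsed]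

lemma elapsed_tendsto : Tendsto elapsed atTop (𝓝 1) := by
  have h1 : Tendsto Real.arctan atTop (𝓝 (Real.pi / 2)) :=
    tendsto_nhds_of_tendsto_nhdsWithin Real.tendsto_arctan_atTop
  have h2 : Tendsto (fun v : ℝ => 2 * v / (1 + v ^ 2)) atTop (𝓝 0) := by
    have h3 : Tendsto (fun v : ℝ => 2 * v⁻¹) atTop (𝓝 0) := by
      simpa using tendsto_inv_atTop_zero.const_mul (2 : ℝ)
    refine squeeze_zero' ?_ ?_ h3
    · filter_upwards [eventually_gt_atTop 0] with v hv
      positivity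
    · filter_upwards [eventually_gt_atTop 0] with v hv
      rw [div_le_iff₀ (by positivity)]
      field_simp
      nlinarith
  have h4 := ((h1.const_mul 2).add h2).div_const Real.pi
  have : (2 * (Real.pi / 2) + 0) / Real.pi = 1 := by
    have := Real.pi_ne_zero
    field_simp
    ring
  rw [this] at h4
  exact h4

lemma elapsed_surj {τ : ℝ} (h0 : 0 ≤ τ) (h1 : τ < 1) : ∃ v, 0 ≤ v ∧ elapsed v = τ := by
  have hc : Continuous elapsed := continuous_iff_continuousAt.2 fun v =>
    (elapsed_hasStrictDerivAt v).hasDerivAt.continuousAt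
  have hex : ∃ b, τ ≤ elapsed b := by
    obtain ⟨b, hb⟩ := (elapsed_tendsto.eventually (lt_mem_nhds h1)).exists
    exact ⟨b, hb.le⟩
  obtain ⟨v, hv⟩ := mem_range_of_exists_le_of_exists_ge hc ⟨0, by rw [elapsed_zero]; exact h0⟩ hex
  refine ⟨v, ?_, hv⟩
  by_contra hneg
  have := elapsed_strictMono (not_le.1 hneg)
  rw [elapsed_zero, hv] at this
  linarith

lemma ode_coeff (v : ℝ) (hv : 0 ≤ v) :
    √2 * (√Real.pi)⁻¹ * (Real.pi / 2 * (1 + v ^ 2)) ^ 2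
      * √(Real.pi / 2 * (1 + v ^ 2) - Real.pi / 2)
    = Real.pi / 2 * (2 * v * (4 / (Real.pi * (1 + v ^ 2) ^ 2))⁻¹) := by
  have hpi := Real.pi_pos
  have e : Real.pi / 2 * (1 + v ^ 2) - Real.pi / 2 = (Real.pi / 2) * v ^ 2 := by ring
  rw [e, Real.sqrt_mul (by positivity), Real.sqrt_sq hv, Real.sqrt_div hpi.le]
  have h2 : √(2 : ℝ) ≠ 0 := by positivity
  have h3 : √Real.pi ≠ 0 := by positivity
  field_simp
  norm_num
  ring

/-- The profile exists. -/
theorem exists_isProfile : ∃ r, IsProfile r := by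
  set g := Function.invFun elapsed with hg
  have hl : ∀ v, g (elapsed v) = v := Function.leftInverse_invFun elapsed_strictMono.injective
  have hd : ∀ v, HasDerivAt (fun t : ℝ => Real.pi / 2 * (1 + g (t - 1) ^ 2))
      (Real.pi / 2 * (2 * v * (4 / (Real.pi * (1 + v ^ 2) ^ 2))⁻¹)) (elapsed v + 1) := by
    intro v
    have hne : 4 / (Real.pi * (1 + v ^ 2) ^ 2) ≠ 0 := by
      have := Real.pi_pos
      positivity
    have h1 := ((elapsed_hasStrictDerivAt v).to_local_left_inverse hne
      (Eventually.of_forall hl)).hasDerivAt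
    have h2 : HasDerivAt (fun t : ℝ => g (t - 1)) (4 / (Real.pi * (1 + v ^ 2) ^ 2))⁻¹
        (elapsed v + 1) := by
      have h1' : HasDerivAt g (4 / (Real.pi * (1 + v ^ 2) ^ 2))⁻¹ ((elapsed v + 1) - 1) := by
        simpa using h1
      exact h1'.comp_sub_const _ _
    have h3 := ((h2.pow 2).const_add 1).const_mul (Real.pi / 2)
    refine h3.congr_deriv ?_
    simp [hl]
  have hode : ∀ t ∈ Ico (1 : ℝ) 2,
      HasDerivAt (fun t : ℝ => Real.pi / 2 * (1 + g (t - 1) ^ 2))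
        (√2 * (√Real.pi)⁻¹ * (Real.pi / 2 * (1 + g (t - 1) ^ 2)) ^ 2
          * √(Real.pi / 2 * (1 + g (t - 1) ^ 2) - Real.pi / 2)) t := by
    intro t ht
    obtain ⟨v, hv, hvt⟩ := elapsed_surj (τ := t - 1) (by linarith [ht.1]) (by linarith [ht.2])
    have h := hd v
    rw [← ode_coeff v hv] at h
    have e : elapsed v + 1 = t := by linarith
    rw [e] at h
    rw [← hvt, hl]
    exact h
  refine ⟨fun t => Real.pi / 2 * (1 + g (t - 1) ^ 2), ?_, ?_, ?_, ?_⟩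
  · rw [contDiffOn_one_iff_derivWithin (uniqueDiffOn_Ico 1 2)]
    refine ⟨fun t ht => (hode t ht).differentiableAt.differentiableWithinAt, ?_⟩
    have hcont : ContinuousOn (fun t : ℝ => Real.pi / 2 * (1 + g (t - 1) ^ 2)) (Ico 1 2) :=
      fun t ht => (hode t ht).continuousAt.continuousWithinAt
    exact ((continuousOn_const.mul (hcont.pow 2)).mul (hcont.sub continuousOn_const).sqrt).congr
      fun t ht => (hode t ht).hasDerivWithinAt.derivWithin (uniqueDiffOn_Ico 1 2 t ht)
  · intro t ht
    exact (hode t ht).hasDerivWithinAt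
  · have : g 0 = 0 := by
      have := hl 0
      rwa [elapsed_zero] at this
    simp [this]
  · intro t ht
    obtain ⟨v, hv, hvt⟩ := elapsed_surj (τ := t - 1) (by linarith [ht.1]) (by linarith [ht.2])
    have hv0 : v ≠ 0 := by
      rintro rfl
      rw [elapsed_zero] at hvt
      linarith [ht.1]
    have hpi := Real.pi_pos
    simp only [← hvt, hl]
    have : 0 < v ^ 2 := by positivity
    nlinarith

lemma IsProfile.elapsed_eq {r : ℝ → ℝ} (hr : IsProfile r) {t : ℝ} (ht : t ∈ Ico (1 : ℝ) 2) :
    elapsed (√(2 / Real.pi * r t - 1)) = t - 1 := by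
  have hpi := Real.pi_pos
  set w : ℝ → ℝ := fun t => √(2 / Real.pi * r t - 1) with hw
  have hec : Continuous elapsed := continuous_iff_continuousAt.2 fun v =>
    (elapsed_hasStrictDerivAt v).hasDerivAt.continuousAt
  have hsub : Icc 1 t ⊆ Ico (1 : ℝ) 2 := fun u hu => ⟨hu.1, hu.2.trans_lt ht.2⟩
  have hcont : ContinuousOn (fun t => elapsed (w t) - t) (Icc 1 t) := by
    have h1 : ContinuousOn r (Icc 1 t) := hr.contDiffOn.continuousOn.mono hsub
    exact (hec.comp_continuousOn
      ((continuousOn_const.mul h1).sub continuousOn_const).sqrt).sub continuousOn_id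
  have hder : ∀ u ∈ Ioo 1 t, HasDerivAt (fun t => elapsed (w t) - t) 0 u := by
    intro u hu
    have hu2 : u ∈ Ioo (1 : ℝ) 2 := ⟨hu.1, hu.2.trans ht.2⟩
    have hgt := hr.gt u hu2
    have hpos : 0 < 2 / Real.pi * r u - 1 := by
      have : 2 / Real.pi * (Real.pi / 2) = 1 := by field_simp
      have h2 : 2 / Real.pi * (Real.pi / 2) < 2 / Real.pi * r u := by gcongr
      linarith
    have hrd := (hr.ode u ⟨hu2.1.le, hu2.2⟩).hasDerivAt (Ico_mem_nhds hu2.1 hu2.2)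
    have hwd := ((hrd.const_mul (2 / Real.pi)).sub_const 1).sqrt hpos.ne'
    have hed := (elapsed_hasStrictDerivAt (w u)).hasDerivAt.comp u hwd
    have hfin := hed.sub (hasDerivAt_id u)
    have hwpos : 0 < w u := Real.sqrt_pos.2 hpos
    have hru : r u = Real.pi / 2 * (1 + (w u) ^ 2) := by
      simp only [hw]
      rw [Real.sq_sqrt hpos.le]
      field_simp
      ring
    have hcoef := ode_coeff (w u) hwpos.le
    rw [← hru] at hcoef
    rw [hcoef] at hfin
    refine hfin.congr_deriv ?_
    have hwne := hwpos.ne'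
    change 4 / (Real.pi * (1 + w u ^ 2) ^ 2) * (2 / Real.pi *
      (Real.pi / 2 * (2 * w u * (4 / (Real.pi * (1 + w u ^ 2) ^ 2))⁻¹)) / (2 * w u)) - 1 = 0
    have h1w : (1 + w u ^ 2) ≠ 0 := by positivity
    field_simp
    norm_num
  rcases eq_or_lt_of_le ht.1 with h1 | h1
  · subst h1
    rw [hr.init]
    have : 2 / Real.pi * (Real.pi / 2) - 1 = 0 := by field_simp; norm_num
    rw [this]
    simp [elapsed_zero]
  · obtain ⟨c, hc, hc'⟩ := exists_hasDerivAt_eq_slope (fun t => elapsed (w t) - t) (fun _ => 0) h1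
      hcont (fun u hu => hder u hu)
    have hz : (elapsed (w t) - t) - (elapsed (w 1) - 1) = 0 := by
      have := sub_pos.2 h1
      field_simp at hc'
      linarith
    have hw1 : w 1 = 0 := by
      simp only [hw, hr.init]
      have : 2 / Real.pi * (Real.pi / 2) - 1 = 0 := by field_simp; norm_num
      rw [this]
      simp
    rw [hw1, elapsed_zero] at hz
    change elapsed (w t) = t - 1
    linarith

/-- The profile is unique on `[1,2)`. -/
theorem IsProfile.eqOn {r r' : ℝ → ℝ} (hr : IsProfile r) (hr' : IsProfile r') :
    EqOn r r' (Ico 1 2) := by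
  have key : ∀ {q : ℝ → ℝ}, IsProfile q → ∀ t ∈ Ico (1 : ℝ) 2, 0 ≤ 2 / Real.pi * q t - 1 := by
    intro q hq t ht
    have hpi := Real.pi_pos
    have hle : Real.pi / 2 ≤ q t := by
      rcases eq_or_lt_of_le ht.1 with h1 | h1
      · rw [← h1, hq.init]
      · exact (hq.gt t ⟨h1, ht.2⟩).le
    have h1 : 2 / Real.pi * (Real.pi / 2) = 1 := by field_simp
    have h2 : 2 / Real.pi * (Real.pi / 2) ≤ 2 / Real.pi * q t := by gcongr
    linarith
  intro t ht
  have h := elapsed_strictMono.injective ((hr.elapsed_eq ht).trans (hr'.elapsed_eq ht).symm)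
  rw [Real.sqrt_inj (key hr t ht) (key hr' t ht)] at h
  have hpi := Real.pi_pos
  have h2 : 2 / Real.pi * r t = 2 / Real.pi * r' t := by linarith
  exact mul_left_cancel₀ (by positivity) h2

/-- The function `r` on `(0,2)`: the unique profile on `[1,2)`, extended by `r(t) = r(2 - t)` to
`(0,1)`. Values outside `(0,2)` have no meaning. -/
def r (t : ℝ) : ℝ :=
  if t < 1 then Classical.choose exists_isProfile (2 - t) else Classical.choose exists_isProfile t

/-- On `[1,2)`, `r` is the profile. -/
theorem r_isProfile : IsProfile r := by
  have h := Classical.choose_spec exists_isProfile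
  have e : EqOn r (Classical.choose exists_isProfile) (Ico 1 2) := fun t ht => by
    simp [r, not_lt.2 ht.1]
  refine ⟨h.contDiffOn.congr e, fun t ht => ?_, ?_, fun t ht => ?_⟩
  · rw [e ht]
    exact (h.ode t ht).congr e (e ht)
  · rw [e ⟨le_rfl, by norm_num⟩]
    exact h.init
  · rw [e ⟨ht.1.le, ht.2⟩]
    exact h.gt t ht

/-! ### The limits `ρ_lim` and `h_lim`, and geodesics -/

/-- `ℓ(t) = 1 / r(t)` on `(0,2)`, with `ℓ(0) = ℓ(2) = 0`. -/
def ell (t : ℝ) : ℝ := if t ∈ Ioo (0 : ℝ) 2 then 1 / r t else 0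

/-- `ρ_lim(t,x) = -(2π)⁻¹ r(t) (1 - x² / ℓ(t)²)₊` for `(t,x) ∈ (0,2) × ℝ`. The values at the times
`0` and `2`, where `r` is infinite, are set to `0`; this is a null set of times. -/
def rhoLim (p : ℝ × ℝ) : ℝ :=
  if p.1 ∈ Ioo (0 : ℝ) 2 then
    -(1 / (2 * Real.pi)) * r p.1 * max (1 - p.2 ^ 2 / ell p.1 ^ 2) 0
  else 0

/-- `γ ∈ H¹((s,y) → (t,x))`: `γ` is absolutely continuous on `[s,t]` with square integrable
derivative, `γ(s) = y` and `γ(t) = x`. Only the restriction of `γ` to `[s,t]` matters. -/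
structure IsH1Path (s y t x : ℝ) (γ : ℝ → ℝ) : Prop where
  absolutelyContinuous : AbsolutelyContinuousOnInterval γ s t
  sq_integrable : IntervalIntegrable (fun u => deriv γ u ^ 2) volume s t
  left : γ s = y
  right : γ t = x

/-- The action `∫₀ᵗ (½ γ̇² - ρ_lim(u, γ(u))) du`. -/
def action (t : ℝ) (γ : ℝ → ℝ) : ℝ :=
  ∫ u in (0 : ℝ)..t, (1 / 2 * deriv γ u ^ 2 - rhoLim (u, γ u))

/-- `h_lim(t,x)`, minus the infimum of the action over `H¹((0,0) → (t,x))`. It takes values in the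
extended reals, and the infimum over the empty set is `⊤`. -/
def hLim (t x : ℝ) : EReal :=
  -⨅ (γ : ℝ → ℝ) (_ : IsH1Path 0 0 t x γ), ((action t γ : ℝ) : EReal)

/-- `γ` is a geodesic from `(0,0)` to `(t,x)`: a path that realizes the infimum in `hLim t x`. -/
structure IsGeodesic (t x : ℝ) (γ : ℝ → ℝ) : Prop where
  path : IsH1Path 0 0 t x γ
  minimal : hLim t x = -((action t γ : ℝ) : EReal)

/-- `(s,y)` and `(t,x)`, with `0 ≤ s < t ≤ 2`, are connected by a geodesic: some geodesic that
starts at `(0,0)` and ends at a time in `[t,2]` passes through both points. -/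
def GeodConnected (s y t x : ℝ) : Prop :=
  0 ≤ s ∧ s < t ∧ ∃ (T X : ℝ) (γ : ℝ → ℝ),
    t ≤ T ∧ T ≤ 2 ∧ IsGeodesic T X γ ∧ γ s = y ∧ γ t = x

/-! ### The Feynman–Kac expectation -/

/-- The Brownian bridge `W_lam ∼ BB_lam((t,x) → (s,y))`, which runs backward in time from `x` at
time `t` to `y` at time `s`, built from a Brownian motion `B`:
`lam^{-1/2} (B(t-u) - (t-u)/(t-s) B(t-s)) + ((u-s) x + (t-u) y)/(t-s)`, for `u ∈ [s,t]`. -/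
def bridge {Ω : Type*} (B : ℝ≥0 → Ω → ℝ) (lam s y t x u : ℝ) (ω : Ω) : ℝ :=
  (√lam)⁻¹ * (B (t - u).toNNReal ω - (t - u) / (t - s) * B (t - s).toNNReal ω)
    + ((u - s) * x + (t - u) * y) / (t - s)

/-- The Feynman–Kac expectation `E[exp(∫ₛᵗ lam ρ(u, W_lam(u)) du)]`. -/
def FK {Ω : Type*} [MeasurableSpace Ω] (P : Measure Ω) (B : ℝ≥0 → Ω → ℝ)
    (lam : ℝ) (ρ : ℝ × ℝ → ℝ) (s y t x : ℝ) : ℝ≥0∞ :=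
  ∫⁻ ω, ENNReal.ofReal
    (Real.exp (∫ u in s..t, lam * ρ (u, bridge B lam s y t x u ω))) ∂P

/-- Lebesgue measure on `[0,2] × ℝ`. -/
def stripMeasure : Measure (ℝ × ℝ) := volume.restrict (Icc (0 : ℝ) 2 ×ˢ univ)

end

end LowerTail

/-! ### The profile `r` on `(0,2)` and the regularity of `rhoLim`. -/

namespace LowerTail

/-! Between two points of a geodesic, `h_lim(t,x) - h_lim(s,y)` is minus the action of the piece
joining them, since a cheaper initial piece could otherwise be spliced in
(`GeodConnected.exists_path`). It therefore suffices to bound `FK` from below along an arbitrary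
`H¹` path `γ`, uniformly in the path and its endpoints (`eventually_exp_le_FK`); minimality of `γ`
plays no further role.

For one path, a Cameron–Martin shift moves the mean of the bridge to `γ`, and Jensen's inequality is
applied under the shifted law (`exp_le_lintegral_exp`, `le_FK`). The shift costs `(λ/2)(∫ γ'² -
(x-y)²/(t-s))`, which produces both the kinetic part of the action and the term `(y-x)²/(2(t-s))`.
It remains to compare `ρ_lim(u, γ(u))` with the average of `ρ^(λ)(u,·)` over a Gaussian of mean
`γ(u)` and variance `b(u)/λ`, where `b` is the bridge variance.

Convergence in `L²` does not control this average directly, because the Gaussian density grows like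
`√λ`. The remedy is to use all the paths `γ + aφ`, `φ = b^{3/4}`, and to average the inequality over
`a ~ N(0,δ²)` (`ofReal_le_lintegral_of_FK_le`). The part of the cost linear in `a` averages to zero
and the quadratic part costs at most `3δ²`, while the variance at time `u` is now at least `δ²φ(u)²`
for every `λ`. The density is then at most `1/(δφ)`, and the error from `ρ^(λ) - ρ_lim` is at most
`k‖ρ^(λ) - ρ_lim‖² + 16/(kδ)`. A power `b^p` serves as `φ` when `p > 1/2`, so that `φ'` is square
integrable, and `p < 1`, so that `1/φ` is integrable.

The last error, the oscillation of `ρ_lim` around `γ`, has modulus `min(r, r²η)`; its time integral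
vanishes as `η → 0` because `r` is integrable (`tendsto_modulus`). Fixing `δ`, then `k`, then taking
`λ` large concludes (`ofReal_le_of_FK_le`). -/

lemma r_symm (t : ℝ) : r (2 - t) = r t := by
  rcases lt_trichotomy t 1 with h | h | h
  · have h1 : ¬ (2 - t < 1) := by linarith
    simp [r, h, h1]
  · subst h; norm_num
  · have h1 : 2 - t < 1 := by linarith
    simp [r, h1, not_lt.2 h.le]

lemma r_eq_abs (t : ℝ) : r t = r (1 + |t - 1|) := by
  rcases le_total 1 t with h | h
  · rw [abs_of_nonneg (by linarith)]; ring_nf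
  · rw [abs_of_nonpos (by linarith), ← r_symm t]; ring_nf

lemma pi_div_two_le_r {t : ℝ} (ht : t ∈ Ioo (0 : ℝ) 2) : Real.pi / 2 ≤ r t := by
  rw [r_eq_abs]
  rcases eq_or_lt_of_le (abs_nonneg (t - 1)) with h | h
  · rw [← h, add_zero, r_isProfile.init]
  · refine (r_isProfile.gt _ ⟨by linarith, ?_⟩).le
    have : |t - 1| < 1 := abs_lt.2 ⟨by linarith [ht.1], by linarith [ht.2]⟩
    linarith

lemma r_pos {t : ℝ} (ht : t ∈ Ioo (0 : ℝ) 2) : 0 < r t :=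
  lt_of_lt_of_le (by positivity) (pi_div_two_le_r ht)

/-- The function `r` on `(0,2)`, extended by `0`, is Borel. -/
lemma measurable_indicator_r : Measurable ((Ioo (0 : ℝ) 2).indicator r) := by
  have h1 : Measurable ((Ico (1 : ℝ) 2).indicator r) := by
    have hc := r_isProfile.contDiffOn.continuousOn
    have := hc.measurable_piecewise (g := fun _ => (0 : ℝ)) continuousOn_const measurableSet_Ico
    rwa [show (fun _ : ℝ => (0 : ℝ)) = 0 from rfl, piecewise_eq_indicator] at this
  -- Continuity is available only on `[1,2)`; the reflection `t ↦ 1 + |t - 1|` transfers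
  -- measurability to all of `(0,2)`.
  have h2 : (Ioo (0 : ℝ) 2).indicator r = fun t => (Ico (1 : ℝ) 2).indicator r (1 + |t - 1|) := by
    ext t
    by_cases ht : t ∈ Ioo (0 : ℝ) 2
    · have h3 : 1 + |t - 1| ∈ Ico (1 : ℝ) 2 := by
        have : |t - 1| < 1 := abs_lt.2 ⟨by linarith [ht.1], by linarith [ht.2]⟩
        exact ⟨by linarith [abs_nonneg (t - 1)], by linarith⟩
      rw [indicator_of_mem ht, indicator_of_mem h3, r_eq_abs]
    · rw [indicator_of_notMem ht, indicator_of_notMem]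
      rintro ⟨-, h⟩
      have := abs_lt.1 (show |t - 1| < 1 by linarith)
      exact ht ⟨by linarith, by linarith⟩
  rw [h2]
  exact h1.comp (by fun_prop)

/-- With `w = (2r/π - 1)^{1/2}` the differential equation gives `(2 arctan w)' = r`. As `arctan` is
bounded, so are the integrals of `r` over `[1,b]`, `b < 2`, although `r` itself may be unbounded. -/
lemma integrableOn_r_Ioc : IntegrableOn r (Ioc 1 2) := by
  have hpi := Real.pi_pos
  set w : ℝ → ℝ := fun t => √(2 / Real.pi * r t - 1) with hw
  have hcr : ContinuousOn r (Ico 1 2) := r_isProfile.contDiffOn.continuousOn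
  have hder : ∀ u ∈ Ioo (1 : ℝ) 2, HasDerivAt (fun t => 2 * Real.arctan (w t)) (r u) u := by
    intro u hu
    have hgt := r_isProfile.gt u hu
    have hpos : 0 < 2 / Real.pi * r u - 1 := by
      have : 2 / Real.pi * (Real.pi / 2) = 1 := by field_simp
      have h2 : 2 / Real.pi * (Real.pi / 2) < 2 / Real.pi * r u := by gcongr
      linarith
    have hrd := (r_isProfile.ode u ⟨hu.1.le, hu.2⟩).hasDerivAt (Ico_mem_nhds hu.1 hu.2)
    have hwd := ((hrd.const_mul (2 / Real.pi)).sub_const 1).sqrt hpos.ne'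
    have hfin := hwd.arctan.const_mul 2
    have hwpos : 0 < w u := Real.sqrt_pos.2 hpos
    have hru : r u = Real.pi / 2 * (1 + (w u) ^ 2) := by
      simp only [hw]
      rw [Real.sq_sqrt hpos.le]
      field_simp
      ring
    have hcoef := ode_coeff (w u) hwpos.le
    rw [← hru] at hcoef
    rw [hcoef] at hfin
    refine hfin.congr_deriv ?_
    have hwne := hwpos.ne'
    change 2 * (1 / (1 + w u ^ 2) * (2 / Real.pi *
      (Real.pi / 2 * (2 * w u * (4 / (Real.pi * (1 + w u ^ 2) ^ 2))⁻¹)) / (2 * w u))) = r u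
    have h1w : (1 + w u ^ 2) ≠ 0 := by positivity
    rw [hru]
    field_simp
    norm_num
  have hb : Tendsto (fun n : ℕ => 2 - 1 / ((n : ℝ) + 1)) atTop (𝓝 2) := by
    simpa using tendsto_one_div_add_atTop_nhds_zero_nat.const_sub (2 : ℝ)
  have hbn : ∀ n : ℕ, 1 ≤ 2 - 1 / ((n : ℝ) + 1) ∧ 2 - 1 / ((n : ℝ) + 1) < 2 := by
    intro n
    have h1 : 1 / ((n : ℝ) + 1) ≤ 1 := by
      rw [div_le_one (by positivity)]; linarith [n.cast_nonneg (α := ℝ)]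
    have h2 : 0 < 1 / ((n : ℝ) + 1) := by positivity
    exact ⟨by linarith, by linarith⟩
  have hsub : ∀ n : ℕ, Icc 1 (2 - 1 / ((n : ℝ) + 1)) ⊆ Ico (1 : ℝ) 2 := fun n u hu =>
    ⟨hu.1, hu.2.trans_lt (hbn n).2⟩
  have hint : ∀ n : ℕ, IntegrableOn r (Ioc 1 (2 - 1 / ((n : ℝ) + 1))) := fun n =>
    ((hcr.mono (hsub n)).integrableOn_Icc).mono_set Ioc_subset_Icc_self
  refine integrableOn_Ioc_of_intervalIntegral_norm_bounded_right (I := 2 * Real.pi) hint hb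
    (Eventually.of_forall fun n => ?_)
  have e : ∫ x in Ioc 1 (2 - 1 / ((n : ℝ) + 1)), ‖r x‖
      = ∫ x in (1 : ℝ)..(2 - 1 / ((n : ℝ) + 1)), r x := by
    rw [intervalIntegral.integral_of_le (hbn n).1]
    refine setIntegral_congr_fun measurableSet_Ioc fun x hx => ?_
    exact Real.norm_of_nonneg (r_pos ⟨by linarith [hx.1], hx.2.trans_lt (hbn n).2⟩).le
  rw [e, intervalIntegral.integral_eq_sub_of_hasDerivAt_of_le (hbn n).1
    (f := fun t => 2 * Real.arctan (w t)) ?_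
    (fun u hu => hder u ⟨hu.1, hu.2.trans (hbn n).2⟩)
    ((intervalIntegrable_iff_integrableOn_Ioc_of_le (hbn n).1).2 (hint n))]
  · have h1 := Real.arctan_lt_pi_div_two (w (2 - 1 / ((n : ℝ) + 1)))
    have h2 := Real.neg_pi_div_two_lt_arctan (w 1)
    linarith
  · have : ContinuousOn w (Icc 1 (2 - 1 / ((n : ℝ) + 1))) :=
      ((continuousOn_const.mul (hcr.mono (hsub n))).sub continuousOn_const).sqrt
    exact continuousOn_const.mul (Real.continuous_arctan.comp_continuousOn this)

/-- The profile `r` is integrable on `(0,2)`. -/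
lemma integrableOn_r : IntegrableOn r (Ioo 0 2) := by
  have h1 : IntegrableOn r (Ioo 1 2) := integrableOn_r_Ioc.mono_set Ioo_subset_Ioc_self
  have h2 : IntegrableOn r (Ioo 0 1) := by
    have h3 : IntervalIntegrable r volume 1 2 :=
      (intervalIntegrable_iff_integrableOn_Ioc_of_le (by norm_num)).2 integrableOn_r_Ioc
    have h4 := h3.comp_sub_left 2
    simp only [r_symm] at h4
    norm_num at h4
    exact ((intervalIntegrable_iff_integrableOn_Ioo_of_le (by norm_num)).1 h4.symm)
  have h3 : IntegrableOn r (Icc 1 1) := by simp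
  refine ((h2.union h3).union h1).mono_set fun t ht => ?_
  rcases lt_trichotomy t 1 with h | h | h
  · exact Or.inl (Or.inl ⟨ht.1, h⟩)
  · exact Or.inl (Or.inr (by simp [h]))
  · exact Or.inr ⟨h, ht.2⟩

lemma rhoLim_of_mem {u : ℝ} (hu : u ∈ Ioo (0 : ℝ) 2) (x : ℝ) :
    rhoLim (u, x) = -(1 / (2 * Real.pi)) * r u * max (1 - (r u * x) ^ 2) 0 := by
  have : r u ≠ 0 := (r_pos hu).ne'
  simp only [rhoLim, hu, if_true, ell]
  congr 3
  field_simp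

lemma rhoLim_of_notMem {u : ℝ} (hu : u ∉ Ioo (0 : ℝ) 2) (x : ℝ) : rhoLim (u, x) = 0 := by
  simp only [rhoLim, hu, if_false]

lemma rhoLim_nonpos (p : ℝ × ℝ) : rhoLim p ≤ 0 := by
  obtain ⟨u, x⟩ := p
  by_cases hu : u ∈ Ioo (0 : ℝ) 2
  · rw [rhoLim_of_mem hu, neg_mul, neg_mul, Left.neg_nonpos_iff]
    have := r_pos hu
    positivity
  · rw [rhoLim_of_notMem hu]

lemma neg_r_le_rhoLim {u : ℝ} (hu : u ∈ Ioo (0 : ℝ) 2) (x : ℝ) : -r u ≤ rhoLim (u, x) := by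
  rw [rhoLim_of_mem hu, neg_mul, neg_mul, neg_le_neg_iff]
  have h1 := r_pos hu
  have h2 : max (1 - (r u * x) ^ 2) 0 ≤ 1 := max_le (by nlinarith [sq_nonneg (r u * x)]) zero_le_one
  have h3 : 1 / (2 * Real.pi) ≤ 1 := by
    rw [div_le_one (by positivity)]; linarith [Real.pi_gt_three]
  calc 1 / (2 * Real.pi) * r u * max (1 - (r u * x) ^ 2) 0 ≤ 1 * r u * 1 := by gcongr
    _ = r u := by ring

lemma abs_rhoLim_le {u : ℝ} (hu : u ∈ Ioo (0 : ℝ) 2) (x : ℝ) : |rhoLim (u, x)| ≤ r u :=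
  abs_le.2 ⟨neg_r_le_rhoLim hu x, (rhoLim_nonpos _).trans (r_pos hu).le⟩

/-- The function `z ↦ (1 - z²)₊` is even and has slope at most `2` in absolute value where it does
not vanish, so the claim reduces to nonnegative arguments. -/
lemma abs_max_one_sub_sq_sub_le (p q : ℝ) :
    |max (1 - p ^ 2) 0 - max (1 - q ^ 2) 0| ≤ 2 * |p - q| := by
  have key : ∀ a b : ℝ, 0 ≤ a → 0 ≤ b →
      max (1 - a ^ 2) 0 - max (1 - b ^ 2) 0 ≤ 2 * |a - b| := by
    intro a b ha hb
    have h0 := abs_nonneg (a - b)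
    rcases le_total (1 - a ^ 2) 0 with h | h
    · rw [max_eq_right h]
      linarith [le_max_right (1 - b ^ 2) 0]
    · rw [max_eq_left h]
      have ha1 : a ≤ 1 := by nlinarith
      rcases le_total b 1 with hb1 | hb1
      · have := le_max_left (1 - b ^ 2) 0
        have h2 := neg_abs_le (a - b)
        nlinarith
      · have := le_max_right (1 - b ^ 2) 0
        have h2 := neg_abs_le (a - b)
        nlinarith
  have h1 := key |p| |q| (abs_nonneg p) (abs_nonneg q)
  have h2 := key |q| |p| (abs_nonneg q) (abs_nonneg p)
  have h3 := abs_abs_sub_abs_le_abs_sub p q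
  rw [abs_sub_comm |q|] at h2
  simp only [sq_abs] at h1 h2
  exact abs_le.2 ⟨by linarith, by linarith⟩

/-- A modulus of continuity in space of `rhoLim`. -/
lemma abs_rhoLim_sub_le {u : ℝ} (hu : u ∈ Ioo (0 : ℝ) 2) (x y : ℝ) :
    |rhoLim (u, x) - rhoLim (u, y)| ≤ min (r u) (r u ^ 2 * |x - y|) := by
  have hr := r_pos hu
  refine le_min ?_ ?_
  · have h1 := neg_r_le_rhoLim hu x
    have h2 := neg_r_le_rhoLim hu y
    have h3 := rhoLim_nonpos (u, x)
    have h4 := rhoLim_nonpos (u, y)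
    exact abs_le.2 ⟨by linarith, by linarith⟩
  · have h1 := abs_max_one_sub_sq_sub_le (r u * x) (r u * y)
    rw [rhoLim_of_mem hu, rhoLim_of_mem hu, ← mul_sub, abs_mul, abs_mul, abs_neg, abs_of_pos hr,
      abs_of_pos (by positivity)]
    have h3 : 1 / (2 * Real.pi) ≤ 1 / 2 := by
      apply one_div_le_one_div_of_le <;> linarith [Real.pi_gt_three]
    calc _ ≤ 1 / 2 * r u * (2 * |r u * x - r u * y|) := by gcongr
      _ = r u ^ 2 * |x - y| := by rw [← mul_sub, abs_mul, abs_of_pos hr]; ring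

lemma measurable_rhoLim : Measurable rhoLim := by
  have h : rhoLim = fun p : ℝ × ℝ => -(1 / (2 * Real.pi)) * (Ioo (0 : ℝ) 2).indicator r p.1
      * max (1 - ((Ioo (0 : ℝ) 2).indicator r p.1 * p.2) ^ 2) 0 := by
    ext ⟨u, x⟩
    by_cases hu : u ∈ Ioo (0 : ℝ) 2
    · rw [rhoLim_of_mem hu]; simp only [indicator_of_mem hu]
    · rw [rhoLim_of_notMem hu]; simp only [indicator_of_notMem hu]; ring
  have hm : Measurable fun p : ℝ × ℝ => (Ioo (0 : ℝ) 2).indicator r p.1 :=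
    measurable_indicator_r.comp measurable_fst
  rw [h]
  exact (hm.const_mul _).mul (((((hm.mul measurable_snd).pow_const 2).const_sub 1)).max
    measurable_const)

lemma integrable_indicator_r : Integrable ((Ioo (0 : ℝ) 2).indicator r) :=
  integrableOn_r.integrable_indicator measurableSet_Ioo

lemma abs_rhoLim_le_indicator (u x : ℝ) : |rhoLim (u, x)| ≤ (Ioo (0 : ℝ) 2).indicator r u := by
  by_cases hu : u ∈ Ioo (0 : ℝ) 2
  · rw [indicator_of_mem hu]; exact abs_rhoLim_le hu x
  · rw [rhoLim_of_notMem hu, indicator_of_notMem hu, abs_zero]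

/-! ### `H¹` paths, their concatenation, and the action along geodesics. -/

lemma AbsolutelyContinuousOnInterval.congr {f g : ℝ → ℝ} {a b : ℝ}
    (hf : AbsolutelyContinuousOnInterval f a b) (h : EqOn f g (uIcc a b)) :
    AbsolutelyContinuousOnInterval g a b := by
  rw [absolutelyContinuousOnInterval_iff] at hf ⊢
  intro ε hε
  obtain ⟨δ, hδ, H⟩ := hf ε hε
  refine ⟨δ, hδ, fun E hE hlt => ?_⟩
  have := H E hE hlt
  rwa [Finset.sum_congr rfl fun i hi => by rw [h (hE.1 i hi).1, h (hE.1 i hi).2]] at this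

lemma IsH1Path.mono {s y T X a b : ℝ} {γ : ℝ → ℝ} (h : IsH1Path s y T X γ)
    (hsa : s ≤ a) (hab : a ≤ b) (hbT : b ≤ T) : IsH1Path a (γ a) b (γ b) γ where
  absolutelyContinuous := h.absolutelyContinuous.mono (by
    rw [uIcc_of_le hab, uIcc_of_le (by linarith)]; exact Icc_subset_Icc hsa hbT)
  sq_integrable := h.sq_integrable.mono_set (by
    rw [uIcc_of_le hab, uIcc_of_le (by linarith)]; exact Icc_subset_Icc hsa hbT)
  left := rfl
  right := rfl

lemma aemeasurable_of_continuousOn_Icc {γ : ℝ → ℝ} {a b : ℝ} (h : ContinuousOn γ (Icc a b)) :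
    AEMeasurable γ (volume.restrict (Ioc a b)) :=
  (h.mono Ioc_subset_Icc_self).aemeasurable measurableSet_Ioc

lemma intervalIntegrable_rhoLim {γ : ℝ → ℝ} {a b : ℝ} (hab : a ≤ b)
    (h : ContinuousOn γ (Icc a b)) :
    IntervalIntegrable (fun u => rhoLim (u, γ u)) volume a b := by
  rw [intervalIntegrable_iff_integrableOn_Ioc_of_le hab]
  refine Integrable.mono' integrable_indicator_r.integrableOn ?_
    (Eventually.of_forall fun u => abs_rhoLim_le_indicator u (γ u))
  exact (measurable_rhoLim.comp_aemeasurable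
    (aemeasurable_id.prodMk (aemeasurable_of_continuousOn_Icc h))).aestronglyMeasurable

lemma IsH1Path.intervalIntegrable_lagrangian {s y t x : ℝ} {γ : ℝ → ℝ} (h : IsH1Path s y t x γ)
    (hst : s ≤ t) :
    IntervalIntegrable (fun u => 1 / 2 * deriv γ u ^ 2 - rhoLim (u, γ u)) volume s t := by
  refine (h.sq_integrable.const_mul _).sub (intervalIntegrable_rhoLim hst ?_)
  have := h.absolutelyContinuous.continuousOn
  rwa [uIcc_of_le hst] at this

lemma integral_congr_uIoc {f g : ℝ → ℝ} {a b : ℝ} (h : EqOn f g (uIoc a b)) :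
    ∫ u in a..b, f u = ∫ u in a..b, g u :=
  intervalIntegral.integral_congr_ae (Eventually.of_forall fun _ hu => h hu)

lemma ae_ne_point (t : ℝ) : ∀ᵐ u : ℝ, u ≠ t := by
  simp [ae_iff]

/-- The path that follows `η` up to time `t` and `γ` afterwards. -/
noncomputable def concat (t : ℝ) (η γ : ℝ → ℝ) (u : ℝ) : ℝ := if u ≤ t then η u else γ u

lemma deriv_concat_of_lt {t u : ℝ} (η γ : ℝ → ℝ) (h : u < t) :
    deriv (concat t η γ) u = deriv η u := by
  refine Filter.EventuallyEq.deriv_eq ?_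
  filter_upwards [eventually_lt_nhds h] with v hv
  simp [concat, hv.le]

lemma deriv_concat_of_gt {t u : ℝ} (η γ : ℝ → ℝ) (h : t < u) :
    deriv (concat t η γ) u = deriv γ u := by
  refine Filter.EventuallyEq.deriv_eq ?_
  filter_upwards [eventually_gt_nhds h] with v hv
  simp [concat, not_le.2 hv]

/-- The concatenated path is `y` plus the primitive of the spliced derivative `g`, and a primitive
of an integrable function is absolutely continuous. The value of the derivative at the junction is
irrelevant. -/
lemma isH1Path_concat {s y t x T X : ℝ} {η γ : ℝ → ℝ} (hst : s ≤ t) (htT : t ≤ T)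
    (hη : IsH1Path s y t x η) (hγ : IsH1Path t x T X γ) :
    IsH1Path s y T X (concat t η γ) := by
  set g : ℝ → ℝ := fun u => if u ≤ t then deriv η u else deriv γ u with hg
  have hg1 : ∀ u ∈ Icc s t, EqOn g (deriv η) (uIoc s u) := by
    intro u hu v hv
    rw [uIoc_of_le hu.1] at hv
    simp [hg, hv.2.trans hu.2]
  have hg2 : ∀ u, t ≤ u → EqOn g (deriv γ) (uIoc t u) := by
    intro u hu v hv
    rw [uIoc_of_le hu] at hv
    simp [hg, not_le.2 hv.1]
  have i1 : IntervalIntegrable g volume s t :=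
    hη.absolutelyContinuous.intervalIntegrable_deriv.congr (hg1 t ⟨hst, le_rfl⟩).symm
  have i2 : IntervalIntegrable g volume t T :=
    hγ.absolutelyContinuous.intervalIntegrable_deriv.congr (hg2 T htT).symm
  have i3 : IntervalIntegrable g volume s T := i1.trans i2
  refine ⟨?_, ?_, ?_, ?_⟩
  · have hac := (i3.absolutelyContinuousOnInterval_intervalIntegral (c := s) (by simp))
    have hc : AbsolutelyContinuousOnInterval (fun _ : ℝ => y) s T :=
      (LipschitzWith.const y).lipschitzOnWith.absolutelyContinuousOnInterval
    refine AbsolutelyContinuousOnInterval.congr (hc.add hac) fun u hu => ?_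
    rw [uIcc_of_le (hst.trans htT)] at hu
    simp only [Pi.add_apply, concat]
    split_ifs with h
    · rw [integral_congr_uIoc (hg1 u ⟨hu.1, h⟩),
        (hη.mono le_rfl hu.1 h).absolutelyContinuous.integral_deriv_eq_sub, hη.left]
      ring
    · have h' := (not_le.1 h).le
      have i4 : IntervalIntegrable g volume t u := i2.mono_set (by
        rw [uIcc_of_le h', uIcc_of_le htT]; exact Icc_subset_Icc_right hu.2)
      rw [← intervalIntegral.integral_add_adjacent_intervals i1 i4,
        integral_congr_uIoc (hg1 t ⟨hst, le_rfl⟩),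
        integral_congr_uIoc (hg2 u h'),
        hη.absolutelyContinuous.integral_deriv_eq_sub,
        (hγ.mono le_rfl h' hu.2).absolutelyContinuous.integral_deriv_eq_sub, hη.left, hη.right,
        hγ.left]
      ring
  · refine IntervalIntegrable.trans (b := t) ?_ ?_
    · refine hη.sq_integrable.congr_ae ?_
      filter_upwards [ae_restrict_of_ae (ae_ne_point t), ae_restrict_mem measurableSet_uIoc]
        with u hu hu2
      rw [uIoc_of_le hst] at hu2
      rw [deriv_concat_of_lt _ _ (lt_of_le_of_ne hu2.2 hu)]
    · refine hγ.sq_integrable.congr fun u hu2 => ?_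
      rw [uIoc_of_le htT] at hu2
      simp only [deriv_concat_of_gt _ _ hu2.1]
  · simp [concat, hst, hη.left]
  · rcases eq_or_lt_of_le htT with h | h
    · subst h
      simp [concat, hη.right, ← hγ.left, hγ.right]
    · simp [concat, not_le.2 h, hγ.right]

lemma action_concat {t x T X : ℝ} {η γ : ℝ → ℝ} (ht : 0 ≤ t) (htT : t ≤ T)
    (hη : IsH1Path 0 0 t x η) (hγ : IsH1Path t x T X γ) :
    action T (concat t η γ) = action t η
      + ∫ u in t..T, (1 / 2 * deriv γ u ^ 2 - rhoLim (u, γ u)) := by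
  have hc := isH1Path_concat ht htT hη hγ
  have hi := hc.intervalIntegrable_lagrangian (ht.trans htT)
  have h1 := hi.mono_set (c := 0) (d := t) (by
    rw [uIcc_of_le ht, uIcc_of_le (ht.trans htT)]; exact Icc_subset_Icc_right htT)
  have h2 := hi.mono_set (c := t) (d := T) (by
    rw [uIcc_of_le htT, uIcc_of_le (ht.trans htT)]; exact Icc_subset_Icc_left ht)
  rw [action, ← intervalIntegral.integral_add_adjacent_intervals h1 h2, action]
  congr 1
  · refine intervalIntegral.integral_congr_ae ?_
    filter_upwards [ae_ne_point t] with u hu hu2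
    rw [uIoc_of_le ht] at hu2
    rw [deriv_concat_of_lt _ _ (lt_of_le_of_ne hu2.2 hu)]
    simp [concat, hu2.2]
  · refine integral_congr_uIoc fun u hu2 => ?_
    rw [uIoc_of_le htT] at hu2
    simp only [deriv_concat_of_gt _ _ hu2.1]
    simp [concat, not_le.2 hu2.1]

lemma neg_action_le_hLim {t x : ℝ} {γ : ℝ → ℝ} (h : IsH1Path 0 0 t x γ) :
    ((-action t γ : ℝ) : EReal) ≤ hLim t x := by
  rw [hLim, EReal.coe_neg, EReal.neg_le_neg_iff]
  exact iInf₂_le γ h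

/-- An initial piece of a geodesic is a geodesic. -/
lemma IsGeodesic.hLim_eq {T X t : ℝ} {γ : ℝ → ℝ} (h : IsGeodesic T X γ) (ht : 0 ≤ t)
    (htT : t ≤ T) : hLim t (γ t) = ((-action t γ : ℝ) : EReal) := by
  refine le_antisymm ?_ ?_
  · rw [hLim, EReal.coe_neg, EReal.neg_le_neg_iff]
    refine le_iInf₂ fun η hη => ?_
    have hγ : IsH1Path t (γ t) T X γ := h.path.right ▸ h.path.mono ht htT le_rfl
    -- A competitor `η` up to time `t`, continued by `γ`, competes with `γ` up to time `T`; the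
    -- common tail cancels.
    have h1 := neg_action_le_hLim (isH1Path_concat ht htT hη hγ)
    have hγ0 : IsH1Path 0 0 t (γ t) γ := by
      have := h.path.mono le_rfl ht htT
      rwa [h.path.left] at this
    rw [h.minimal, ← EReal.coe_neg, EReal.coe_le_coe_iff, action_concat ht htT hη hγ] at h1
    have h2 : action T γ = action t γ + ∫ u in t..T, (1 / 2 * deriv γ u ^ 2 - rhoLim (u, γ u)) :=
      (intervalIntegral.integral_add_adjacent_intervals (hγ0.intervalIntegrable_lagrangian ht)
        (hγ.intervalIntegrable_lagrangian htT)).symm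
    exact EReal.coe_le_coe_iff.2 (by linarith)
  · refine neg_action_le_hLim ?_
    have := h.path.mono le_rfl ht htT
    rwa [h.path.left] at this

/-- Two points connected by a geodesic are connected by an `H¹` path whose action is the difference
of the values of `hLim`. -/
lemma GeodConnected.exists_path {s y t x : ℝ} (h : GeodConnected s y t x) :
    0 ≤ s ∧ s < t ∧ t ≤ 2 ∧ ∃ γ, IsH1Path s y t x γ ∧
      hLim t x - hLim s y
        = ((-∫ u in s..t, (1 / 2 * deriv γ u ^ 2 - rhoLim (u, γ u)) : ℝ) : EReal) := by
  obtain ⟨hs, hst, T, X, γ, htT, hT, hγ, rfl, rfl⟩ := h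
  have hp := hγ.path.mono hs hst.le htT
  refine ⟨hs, hst, htT.trans hT, γ, hp, ?_⟩
  rw [hγ.hLim_eq (hs.trans hst.le) htT, hγ.hLim_eq hs (hst.le.trans htT), ← EReal.coe_sub]
  have h0 := hγ.path.mono le_rfl hs (hst.le.trans htT)
  have : action t γ = action s γ + ∫ u in s..t, (1 / 2 * deriv γ u ^ 2 - rhoLim (u, γ u)) :=
    (intervalIntegral.integral_add_adjacent_intervals (h0.intervalIntegrable_lagrangian hs)
      (hp.intervalIntegrable_lagrangian hst.le)).symm
  rw [this]
  congr 1
  ring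

end LowerTail

/-! ### Transport of vectors between families with the same Gram matrix. -/

namespace LowerTail

open scoped RealInnerProductSpace

section Gram

variable {ι H₁ H₂ : Type*} [NormedAddCommGroup H₁] [InnerProductSpace ℝ H₁]
  [NormedAddCommGroup H₂] [InnerProductSpace ℝ H₂]

lemma inner_linearCombination_eq {a : ι → H₁} {b : ι → H₂}
    (h : ∀ i j, ⟪a i, a j⟫ = ⟪b i, b j⟫) (c d : ι →₀ ℝ) :
    ⟪Finsupp.linearCombination ℝ a c, Finsupp.linearCombination ℝ a d⟫
      = ⟪Finsupp.linearCombination ℝ b c, Finsupp.linearCombination ℝ b d⟫ := by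
  simp only [Finsupp.linearCombination_apply, Finsupp.sum, sum_inner, inner_sum,
    real_inner_smul_left, real_inner_smul_right, h]

/-- If two families have the same Gram matrix, every vector of the first Hilbert space has a
counterpart in the closed span of the second family. -/
lemma exists_inner_eq_of_gram [CompleteSpace H₁] [CompleteSpace H₂] {a : ι → H₁} {b : ι → H₂}
    (h : ∀ i j, ⟪a i, a j⟫ = ⟪b i, b j⟫) (f : H₁) :
    ∃ X ∈ (Submodule.span ℝ (range b)).topologicalClosure,
      (∀ i, ⟪X, b i⟫ = ⟪f, a i⟫) ∧ ‖X‖ ≤ ‖f‖ := by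
  set K := (Submodule.span ℝ (range a)).topologicalClosure with hK
  have : CompleteSpace K := (Submodule.isClosed_topologicalClosure _).completeSpace_coe
  -- The pairings with the `a i` see only the projection of `f` on their closed span. It is a limit
  -- of finite combinations, whose coefficients are reused on the family `b`.
  set p : H₁ := (K.orthogonalProjectionOnto f : H₁) with hp
  have hpK : p ∈ closure (Submodule.span ℝ (range a) : Set H₁) := by
    rw [← Submodule.topologicalClosure_coe]; exact (K.orthogonalProjectionOnto f).2
  obtain ⟨v, hv, hvp⟩ := mem_closure_iff_seq_limit.1 hpK
  have : ∀ n, ∃ c : ι →₀ ℝ, Finsupp.linearCombination ℝ a c = v n := fun n =>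
    (Finsupp.mem_span_range_iff_exists_finsupp.1 (hv n))
  choose c hc using this
  -- Equal Gram matrices make this transfer of coefficients isometric, so the transported sequence
  -- is Cauchy as well.
  have hdist : ∀ m n, dist (Finsupp.linearCombination ℝ b (c m))
      (Finsupp.linearCombination ℝ b (c n)) = dist (v m) (v n) := by
    intro m n
    rw [dist_eq_norm, dist_eq_norm, ← hc, ← hc, ← map_sub, ← map_sub, norm_eq_sqrt_real_inner,
      norm_eq_sqrt_real_inner, inner_linearCombination_eq h]
  have hcau : CauchySeq fun n => Finsupp.linearCombination ℝ b (c n) := by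
    have := hvp.cauchySeq
    rw [Metric.cauchySeq_iff] at this ⊢
    simpa only [hdist] using this
  obtain ⟨X, hX⟩ := cauchySeq_tendsto_of_complete hcau
  refine ⟨X, ?_, fun i => ?_, ?_⟩
  · rw [← SetLike.mem_coe, Submodule.topologicalClosure_coe]
    refine mem_closure_of_tendsto hX (Eventually.of_forall fun n => ?_)
    exact Finsupp.mem_span_range_iff_exists_finsupp.2 ⟨c n, rfl⟩
  · have h1 : Tendsto (fun n => ⟪Finsupp.linearCombination ℝ b (c n), b i⟫) atTop (𝓝 ⟪X, b i⟫) :=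
      hX.inner tendsto_const_nhds
    have h2 : Tendsto (fun n => ⟪v n, a i⟫) atTop (𝓝 ⟪p, a i⟫) := hvp.inner tendsto_const_nhds
    have h3 : ∀ n, ⟪Finsupp.linearCombination ℝ b (c n), b i⟫ = ⟪v n, a i⟫ := by
      intro n
      have := inner_linearCombination_eq h (c n) (Finsupp.single i 1)
      simp only [Finsupp.linearCombination_single, one_smul, hc] at this
      exact this.symm
    simp only [h3] at h1
    rw [tendsto_nhds_unique h1 h2]
    have hi : a i ∈ K := Submodule.le_topologicalClosure _ (Submodule.subset_span ⟨i, rfl⟩)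
    have := K.starProjection_inner_eq_zero f (a i) hi
    rw [inner_sub_left] at this
    exact (sub_eq_zero.1 this).symm
  · have h1 := hX.norm
    have h2 := hvp.norm
    have h3 : ∀ n, ‖Finsupp.linearCombination ℝ b (c n)‖ = ‖v n‖ := by
      intro n
      rw [norm_eq_sqrt_real_inner, norm_eq_sqrt_real_inner, ← hc, inner_linearCombination_eq h]
    simp only [h3] at h1
    rw [tendsto_nhds_unique h1 h2]
    exact K.norm_orthogonalProjectionOnto_apply_le f

end Gram

/-! ### The Gaussian Hilbert space of Brownian motion and its exponential tilts. -/

section Gaussian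

variable {Ω : Type*} [MeasurableSpace Ω] {P : Measure Ω} {B : ℝ≥0 → Ω → ℝ}

/-- The element `B τ` of `L²(P)`. -/
noncomputable def brownianLp (hB : IsPreBrownianReal B P) (τ : ℝ≥0) : Lp ℝ 2 P :=
  (hB.isGaussianProcess.hasGaussianLaw_eval τ).memLp_two.toLp (B τ)

lemma coeFn_brownianLp (hB : IsPreBrownianReal B P) (τ : ℝ≥0) :
    brownianLp hB τ =ᵐ[P] B τ := MemLp.coeFn_toLp _

lemma inner_brownianLp (hB : IsPreBrownianReal B P) (σ τ : ℝ≥0) :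
    ⟪brownianLp hB σ, brownianLp hB τ⟫ = (min σ τ : ℝ≥0) := by
  have hP := hB.isGaussianProcess.isProbabilityMeasure
  have h1 := hB.covariance_eval σ τ
  rw [covariance_eq_sub (hB.isGaussianProcess.hasGaussianLaw_eval σ).memLp_two
    (hB.isGaussianProcess.hasGaussianLaw_eval τ).memLp_two, hB.integral_eval, zero_mul,
    sub_zero] at h1
  rw [L2.inner_def, ← h1]
  refine integral_congr_ae ?_
  filter_upwards [coeFn_brownianLp hB σ, coeFn_brownianLp hB τ] with ω h2 h3
  rw [h2, h3]
  simp [mul_comm]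

/-- The Gaussian Hilbert space of the process `B`. -/
noncomputable def gaussianSpace (hB : IsPreBrownianReal B P) : Submodule ℝ (Lp ℝ 2 P) :=
  (Submodule.span ℝ (range (brownianLp hB))).topologicalClosure

lemma brownianLp_mem (hB : IsPreBrownianReal B P) (τ : ℝ≥0) :
    brownianLp hB τ ∈ gaussianSpace hB :=
  Submodule.le_topologicalClosure _ (Submodule.subset_span ⟨τ, rfl⟩)

lemma norm_exp_I_mul_sub_le (x y : ℝ) :
    ‖Complex.exp (x * Complex.I) - Complex.exp (y * Complex.I)‖ ≤ |x - y| := by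
  have h : Complex.exp (x * Complex.I) - Complex.exp (y * Complex.I)
      = Complex.exp (y * Complex.I) * (Complex.exp (Complex.I * ((x - y : ℝ) : ℂ)) - 1) := by
    rw [mul_sub, ← Complex.exp_add, mul_one]
    congr 2
    push_cast
    ring
  rw [h, norm_mul, Complex.norm_exp_ofReal_mul_I, one_mul]
  exact Real.norm_exp_I_mul_ofReal_sub_one_le

lemma integrable_exp_I_mul [IsFiniteMeasure P] (Z : Lp ℝ 2 P) :
    Integrable (fun ω => Complex.exp ((Z ω : ℝ) * Complex.I)) P := by
  refine Integrable.of_bound ?_ 1 (Eventually.of_forall fun ω => ?_)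
  · have := (Lp.aestronglyMeasurable Z).aemeasurable
    exact AEMeasurable.aestronglyMeasurable (by fun_prop)
  · rw [Complex.norm_exp_ofReal_mul_I]

/-- The map is 1-Lipschitz because `x ↦ e^{ix}` is and the `L¹` norm is at most the `L²` norm. This
carries the Gaussian characteristic function from the span to its closure. -/
lemma continuous_integral_exp_I_mul [IsProbabilityMeasure P] :
    Continuous fun Z : Lp ℝ 2 P => ∫ ω, Complex.exp ((Z ω : ℝ) * Complex.I) ∂P := by
  refine (LipschitzWith.of_dist_le_mul (K := 1) fun Z Z' => ?_).continuous
  rw [NNReal.coe_one, one_mul, dist_eq_norm, dist_eq_norm,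
    ← integral_sub (integrable_exp_I_mul Z) (integrable_exp_I_mul Z')]
  have h2 : MemLp (Z - Z' : Lp ℝ 2 P) 1 P := (Lp.memLp (Z - Z')).mono_exponent (by norm_num)
  have h1 : Integrable (fun ω => ‖(Z - Z' : Lp ℝ 2 P) ω‖) P := (memLp_one_iff_integrable.1 h2).norm
  calc _ ≤ ∫ ω, ‖(Z - Z' : Lp ℝ 2 P) ω‖ ∂P := by
        refine norm_integral_le_of_norm_le h1 ?_
        filter_upwards [Lp.coeFn_sub Z Z'] with ω hω
        rw [hω]
        exact norm_exp_I_mul_sub_le _ _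
    _ ≤ ‖Z - Z'‖ := by
        rw [Lp.norm_def, integral_norm_eq_lintegral_enorm (Lp.aestronglyMeasurable _),
          ← eLpNorm_one_eq_lintegral_enorm]
        exact ENNReal.toReal_mono (Lp.eLpNorm_ne_top _)
          (eLpNorm_le_eLpNorm_of_exponent_le (by norm_num) (Lp.aestronglyMeasurable _))

lemma integral_exp_I_mul_of_mem_span (hB : IsPreBrownianReal B P) {Z : Lp ℝ 2 P}
    (hZ : Z ∈ Submodule.span ℝ (range (brownianLp hB))) :
    ∫ ω, Complex.exp ((Z ω : ℝ) * Complex.I) ∂P = Complex.exp (-(‖Z‖ ^ 2 / 2 : ℝ)) := by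
  have hP := hB.isGaussianProcess.isProbabilityMeasure
  obtain ⟨c, hc⟩ := Finsupp.mem_span_range_iff_exists_finsupp.1 hZ
  have hsum : (Z : Ω → ℝ) =ᵐ[P] fun ω => ∑ i ∈ c.support, c i * B i ω := by
    rw [← hc, Finsupp.sum]
    have h1 := Lp.coeFn_finsetSum c.support (fun i => c i • brownianLp hB i)
    have h2 : ∀ i ∈ c.support, (c i • brownianLp hB i : Lp ℝ 2 P) =ᵐ[P] fun ω => c i * B i ω := by
      intro i _
      filter_upwards [Lp.coeFn_smul (c i) (brownianLp hB i), coeFn_brownianLp hB i] with ω h3 h4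
      rw [h3, Pi.smul_apply, h4, smul_eq_mul]
    have h3 : ∀ᵐ ω ∂P, ∀ i ∈ c.support, (c i • brownianLp hB i : Lp ℝ 2 P) ω = c i * B i ω :=
      (Finset.eventually_all c.support).2 h2
    filter_upwards [h1, h3] with ω h4 h5
    rw [h4]
    simp only [Finset.sum_apply]
    exact Finset.sum_congr rfl fun i hi => h5 i hi
  have hmean : ∫ ω, Z ω ∂P = 0 := by
    rw [integral_congr_ae hsum, integral_finsetSum _ fun i _ => (hB.integrable_eval i).const_mul _]
    refine Finset.sum_eq_zero fun i _ => ?_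
    rw [integral_const_mul, hB.integral_eval, mul_zero]
  have hG : HasGaussianLaw (Z : Ω → ℝ) P := by
    have h1 := (hB.isGaussianProcess.hasGaussianLaw c.support).map_fun
      (∑ i : c.support, c i • ContinuousLinearMap.proj (R := ℝ) (φ := fun _ : c.support => ℝ) i)
    refine h1.congr ?_
    filter_upwards [hsum] with ω hω
    rw [hω, ← Finset.sum_coe_sort c.support (fun i => c i * B i ω)]
    simp
  have hvar : Var[Z; P] = ‖Z‖ ^ 2 := by
    rw [variance_eq_sub (Lp.memLp Z), hmean, ← real_inner_self_eq_norm_sq, L2.inner_def]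
    simp [pow_two]
  have hmap := hG.map_eq_gaussianReal
  rw [hmean, hvar] at hmap
  have h1 := charFun_gaussianReal (μ := 0) (v := (‖Z‖ ^ 2).toNNReal) 1
  rw [← hmap, charFun_apply_real, integral_map (Lp.aestronglyMeasurable Z).aemeasurable
    (by fun_prop)] at h1
  simpa [Real.coe_toNNReal _ (sq_nonneg ‖Z‖), neg_div] using h1

/-- Every element of the Gaussian space is a centred Gaussian. -/
lemma map_eq_gaussianReal_of_mem (hB : IsPreBrownianReal B P) {Z : Lp ℝ 2 P}
    (hZ : Z ∈ gaussianSpace hB) : P.map Z = gaussianReal 0 (‖Z‖₊ ^ 2) := by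
  have hP := hB.isGaussianProcess.isProbabilityMeasure
  have key : ∀ Z ∈ gaussianSpace hB,
      ∫ ω, Complex.exp ((Z ω : ℝ) * Complex.I) ∂P = Complex.exp (-(‖Z‖ ^ 2 / 2 : ℝ)) := by
    intro Z hZ
    have hcl : IsClosed {Z : Lp ℝ 2 P |
        ∫ ω, Complex.exp ((Z ω : ℝ) * Complex.I) ∂P = Complex.exp (-(‖Z‖ ^ 2 / 2 : ℝ))} :=
      isClosed_eq continuous_integral_exp_I_mul (by fun_prop)
    have hZ' : Z ∈ closure (Submodule.span ℝ (range (brownianLp hB)) : Set (Lp ℝ 2 P)) := by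
      rw [← Submodule.topologicalClosure_coe]; exact hZ
    exact closure_minimal (fun Z hZ => integral_exp_I_mul_of_mem_span hB hZ) hcl hZ'
  have hm := (Lp.aestronglyMeasurable Z).aemeasurable
  have : IsProbabilityMeasure (P.map Z) := Measure.isProbabilityMeasure_map hm
  refine Measure.ext_of_charFun ?_
  ext t
  rw [charFun_apply_real, integral_map hm (by fun_prop), charFun_gaussianReal]
  -- The Gaussian space is a linear subspace, so the identity at frequency `1` for `t • Z` is the
  -- identity at frequency `t` for `Z`.
  have h1 := key (t • Z) (Submodule.smul_mem _ _ hZ)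
  have h2 : ∫ ω, Complex.exp (((t • Z : Lp ℝ 2 P) ω : ℝ) * Complex.I) ∂P
      = ∫ ω, Complex.exp (t * (Z ω) * Complex.I) ∂P := by
    refine integral_congr_ae ?_
    filter_upwards [Lp.coeFn_smul t Z] with ω hω
    rw [hω]
    simp
  rw [← h2, h1, norm_smul]
  congr 1
  simp only [Real.norm_eq_abs, mul_pow, sq_abs]
  push_cast
  simp
  ring

lemma mgf_of_mem (hB : IsPreBrownianReal B P) {Z : Lp ℝ 2 P}
    (hZ : Z ∈ gaussianSpace hB) : ∫ ω, Real.exp (Z ω) ∂P = Real.exp (‖Z‖ ^ 2 / 2) := by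
  have h := mgf_gaussianReal (map_eq_gaussianReal_of_mem hB hZ) 1
  simpa [mgf] using h

/-- The measure `P` tilted by the Gaussian variable `X`. -/
noncomputable def tilt (P : Measure Ω) (X : Lp ℝ 2 P) : Measure Ω :=
  P.withDensity fun ω => ENNReal.ofReal (Real.exp (X ω - ‖X‖ ^ 2 / 2))

lemma aemeasurable_tilt_density (X : Lp ℝ 2 P) :
    AEMeasurable (fun ω => Real.exp (X ω - ‖X‖ ^ 2 / 2)) P := by
  have := (Lp.aestronglyMeasurable X).aemeasurable
  fun_prop

lemma tilt_absolutelyContinuous (X : Lp ℝ 2 P) : tilt P X ≪ P :=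
  withDensity_absolutelyContinuous _ _

lemma integral_tilt (X : Lp ℝ 2 P) (g : Ω → ℝ) :
    ∫ ω, g ω ∂(tilt P X) = ∫ ω, Real.exp (X ω - ‖X‖ ^ 2 / 2) * g ω ∂P := by
  rw [tilt, integral_withDensity_eq_integral_toReal_smul₀
    (aemeasurable_tilt_density X).ennreal_ofReal (by simp)]
  refine integral_congr_ae (Eventually.of_forall fun ω => ?_)
  simp [ENNReal.toReal_ofReal (Real.exp_pos _).le]

lemma integrable_tilt_iff (X : Lp ℝ 2 P) (g : Ω → ℝ) :
    Integrable g (tilt P X) ↔ Integrable (fun ω => Real.exp (X ω - ‖X‖ ^ 2 / 2) * g ω) P := by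
  rw [tilt, integrable_withDensity_iff_integrable_smul₀'
    (aemeasurable_tilt_density X).ennreal_ofReal (by simp)]
  refine integrable_congr (Eventually.of_forall fun ω => ?_)
  simp [ENNReal.toReal_ofReal (Real.exp_pos _).le]

/-- The variable `X + t • Y` is again a centred Gaussian; expanding the square of its norm leaves
the cross term `t⟪X, Y⟫`, which is the shift of the mean. -/
lemma integral_exp_mul_tilt (hB : IsPreBrownianReal B P) {X Y : Lp ℝ 2 P}
    (hX : X ∈ gaussianSpace hB) (hY : Y ∈ gaussianSpace hB) (t : ℝ) :
    ∫ ω, Real.exp (t * Y ω) ∂(tilt P X) = Real.exp (⟪X, Y⟫ * t + ‖Y‖ ^ 2 * t ^ 2 / 2) := by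
  have hmem : X + t • Y ∈ gaussianSpace hB :=
    Submodule.add_mem _ hX (Submodule.smul_mem _ _ hY)
  have h : ∫ ω, Real.exp (X ω - ‖X‖ ^ 2 / 2) * Real.exp (t * Y ω) ∂P
      = ∫ ω, Real.exp (-(‖X‖ ^ 2 / 2)) * Real.exp ((X + t • Y : Lp ℝ 2 P) ω) ∂P := by
    refine integral_congr_ae ?_
    filter_upwards [Lp.coeFn_add X (t • Y), Lp.coeFn_smul t Y] with ω h1 h2
    rw [h1, Pi.add_apply, h2, ← Real.exp_add, ← Real.exp_add]
    simp only [Pi.smul_apply, smul_eq_mul]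
    ring_nf
  rw [integral_tilt, h, integral_const_mul, mgf_of_mem hB hmem, ← Real.exp_add,
    norm_add_sq_real, norm_smul, real_inner_smul_right, mul_pow, Real.norm_eq_abs, sq_abs]
  ring_nf

lemma isProbabilityMeasure_tilt (hB : IsPreBrownianReal B P) {X : Lp ℝ 2 P}
    (hX : X ∈ gaussianSpace hB) : IsProbabilityMeasure (tilt P X) := by
  have hP := hB.isGaussianProcess.isProbabilityMeasure
  have h1 : ∫ ω, Real.exp (X ω - ‖X‖ ^ 2 / 2) ∂P = 1 := by
    -- At parameter `0` this says that the density has integral `1`; a nonzero Bochner integral also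
    -- forces integrability.
    have := integral_exp_mul_tilt hB hX hX 0
    rw [integral_tilt] at this
    simpa using this
  have h2 : Integrable (fun ω => Real.exp (X ω - ‖X‖ ^ 2 / 2)) P := by
    by_contra h
    rw [integral_undef h] at h1
    exact zero_ne_one h1
  refine ⟨?_⟩
  rw [tilt, withDensity_apply _ MeasurableSet.univ, Measure.restrict_univ,
    ← ofReal_integral_eq_lintegral_ofReal h2 (Eventually.of_forall fun ω => (Real.exp_pos _).le),
    h1, ENNReal.ofReal_one]

/-- Under the measure tilted by `X`, the mean of `Y` is shifted by the covariance. -/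
lemma map_tilt_eq_gaussianReal (hB : IsPreBrownianReal B P) {X Y : Lp ℝ 2 P}
    (hX : X ∈ gaussianSpace hB) (hY : Y ∈ gaussianSpace hB) :
    (tilt P X).map Y = gaussianReal ⟪X, Y⟫ (‖Y‖₊ ^ 2) := by
  have hQ := isProbabilityMeasure_tilt hB hX
  have hm : AEMeasurable Y (tilt P X) :=
    (Lp.aestronglyMeasurable Y).aemeasurable.mono_ac (tilt_absolutelyContinuous X)
  have hmgf : mgf id (gaussianReal ⟪X, Y⟫ (‖Y‖₊ ^ 2)) = mgf Y (tilt P X) := by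
    rw [mgf_id_gaussianReal]
    ext t
    rw [mgf, integral_exp_mul_tilt hB hX hY]
    simp
  -- The moment generating function is finite on the whole line, so it determines its analytic
  -- continuation and hence the law.
  have h := Measure.ext_of_complexMGF_eq (X := id) (μ := gaussianReal ⟪X, Y⟫ (‖Y‖₊ ^ 2))
    aemeasurable_id hm (by
      ext z
      refine eqOn_complexMGF_of_mgf hmgf ?_
      simp [integrableExpSet_id_gaussianReal])
  rw [← h, Measure.map_id]

/-- Existence of the Wiener integral of `f`, for the time-reversed motion on `[s,t]`. -/
lemma exists_wiener (hB : IsPreBrownianReal B P) {s t : ℝ} {f : ℝ → ℝ}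
    (hf : MemLp f 2 (volume.restrict (Ioc s t))) (hst : s ≤ t) :
    ∃ X ∈ gaussianSpace hB,
      (∀ u ∈ Icc s t, ⟪X, brownianLp hB (t - u).toNNReal⟫ = ∫ w in u..t, f w) ∧
      ‖X‖ ^ 2 ≤ ∫ w in s..t, f w ^ 2 := by
  have hfin : ∀ u, volume.restrict (Ioc s t) (Ioc u t) ≠ ∞ := fun u =>
    (measure_lt_top _ _).ne
  -- The indicators of `(u,t]` have Gram matrix `t - max u v = min (t-u) (t-v)`, which is the
  -- covariance of `B(t-u)` and `B(t-v)`.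
  set a : Icc s t → Lp ℝ 2 (volume.restrict (Ioc s t)) := fun u =>
    indicatorConstLp 2 (measurableSet_Ioc (a := (u : ℝ)) (b := t)) (hfin u) 1 with ha
  set b : Icc s t → Lp ℝ 2 P := fun u => brownianLp hB (t - u).toNNReal with hb
  have hgram : ∀ u v, ⟪a u, a v⟫ = ⟪b u, b v⟫ := by
    intro u v
    simp only [ha, hb]
    rw [inner_brownianLp, L2.inner_indicatorConstLp_one, setIntegral_indicatorConstLp
      measurableSet_Ioc]
    have h1 : Ioc (v : ℝ) t ∩ Ioc (u : ℝ) t = Ioc (max v u : ℝ) t := by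
      ext w; simp only [mem_inter_iff, mem_Ioc, max_lt_iff]; tauto
    have h2 : Ioc (max v u : ℝ) t ∩ Ioc s t = Ioc (max v u : ℝ) t := by
      refine inter_eq_left.2 (Ioc_subset_Ioc_left ?_)
      exact le_max_of_le_left v.2.1
    rw [h1, smul_eq_mul, mul_one, measureReal_restrict_apply measurableSet_Ioc, h2,
      Real.volume_real_Ioc_of_le (max_le v.2.2 u.2.2), NNReal.coe_min,
      Real.coe_toNNReal _ (sub_nonneg.2 u.2.2), Real.coe_toNNReal _ (sub_nonneg.2 v.2.2),
      min_sub_sub_left, max_comm]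
  obtain ⟨X, hX, hXi, hXn⟩ := exists_inner_eq_of_gram hgram (hf.toLp f)
  refine ⟨X, ?_, fun u hu => ?_, ?_⟩
  · exact Submodule.topologicalClosure_mono (Submodule.span_mono (by
      rintro _ ⟨u, rfl⟩; exact ⟨_, rfl⟩)) hX
  · have := hXi ⟨u, hu⟩
    simp only [ha, hb] at this
    rw [this, real_inner_comm, L2.inner_indicatorConstLp_one,
      intervalIntegral.integral_of_le hu.2, Measure.restrict_restrict measurableSet_Ioc,
      inter_eq_left.2 (Ioc_subset_Ioc_left hu.1)]
    refine integral_congr_ae ?_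
    have h1 := hf.coeFn_toLp
    exact ae_mono (Measure.restrict_mono (Ioc_subset_Ioc_left hu.1) le_rfl) h1
  · calc ‖X‖ ^ 2 ≤ ‖hf.toLp f‖ ^ 2 := by gcongr
      _ = ∫ w in s..t, f w ^ 2 := by
        rw [← real_inner_self_eq_norm_sq, L2.inner_def, intervalIntegral.integral_of_le hst]
        refine integral_congr_ae ?_
        filter_upwards [hf.coeFn_toLp] with w hw
        rw [hw]
        simp [pow_two]

end Gaussian

end LowerTail

/-! ### Jensen's inequality under the tilt, joint measurability, and the law of the bridge. -/

namespace LowerTail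

open scoped RealInnerProductSpace

/-- Discarding the negative part only increases the integral. Lower bounds thus pass to `lintegral`
with no finiteness assumption on the larger quantity they bound. -/
lemma ofReal_integral_le_lintegral_ofReal {α : Type*} [MeasurableSpace α] {μ : Measure α}
    {g : α → ℝ} (hg : Integrable g μ) :
    ENNReal.ofReal (∫ a, g a ∂μ) ≤ ∫⁻ a, ENNReal.ofReal (g a) ∂μ := by
  have h1 : Integrable (fun a => max (g a) 0) μ := hg.pos_part
  calc ENNReal.ofReal (∫ a, g a ∂μ) ≤ ENNReal.ofReal (∫ a, max (g a) 0 ∂μ) :=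
        ENNReal.ofReal_le_ofReal (integral_mono hg h1 fun a => le_max_left _ _)
    _ = ∫⁻ a, ENNReal.ofReal (max (g a) 0) ∂μ :=
        ofReal_integral_eq_lintegral_ofReal h1 (Eventually.of_forall fun a => le_max_right _ _)
    _ = ∫⁻ a, ENNReal.ofReal (g a) ∂μ := by simp

variable {Ω : Type*} [MeasurableSpace Ω] {P : Measure Ω} {B : ℝ≥0 → Ω → ℝ}

lemma integrable_and_integral_tilt (hB : IsPreBrownianReal B P) {X Y : Lp ℝ 2 P}
    (hX : X ∈ gaussianSpace hB) (hY : Y ∈ gaussianSpace hB) :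
    Integrable Y (tilt P X) ∧ ∫ ω, Y ω ∂(tilt P X) = ⟪X, Y⟫ := by
  have hm : AEMeasurable Y (tilt P X) :=
    (Lp.aestronglyMeasurable Y).aemeasurable.mono_ac (tilt_absolutelyContinuous X)
  have h := map_tilt_eq_gaussianReal hB hX hY
  constructor
  · have h1 : Integrable id (gaussianReal ⟪X, Y⟫ (‖Y‖₊ ^ 2)) :=
      memLp_one_iff_integrable.1 (memLp_id_gaussianReal 1)
    rw [← h] at h1
    exact h1.comp_aemeasurable hm
  · have h1 := integral_id_gaussianReal (μ := ⟪X, Y⟫) (v := ‖Y‖₊ ^ 2)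
    rw [← h, integral_map hm (by fun_prop)] at h1
    exact h1

/-- Jensen's inequality after a change of measure. -/
lemma exp_le_lintegral_exp (hB : IsPreBrownianReal B P) {X : Lp ℝ 2 P}
    (hX : X ∈ gaussianSpace hB) {G : Ω → ℝ} (hG : Integrable G (tilt P X)) :
    ENNReal.ofReal (Real.exp (∫ ω, G ω ∂(tilt P X) - ‖X‖ ^ 2 / 2))
      ≤ ∫⁻ ω, ENNReal.ofReal (Real.exp (G ω)) ∂P := by
  have hQ := isProbabilityMeasure_tilt hB hX
  obtain ⟨hXi, hXm⟩ := integrable_and_integral_tilt hB hX hX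
  rw [real_inner_self_eq_norm_sq] at hXm
  set m := ∫ ω, G ω ∂(tilt P X) - ‖X‖ ^ 2 / 2 with hm
  -- After the change of measure the exponent is `w = G - X + ‖X‖²/2`, whose mean under the tilt is
  -- `m`. Replacing `exp w` by its tangent `e^m (1 + w - m)` gives Jensen's inequality without
  -- integrability of `exp w`.
  set g : Ω → ℝ := fun ω => Real.exp m * (1 + (G ω - X ω + ‖X‖ ^ 2 / 2) - m) with hg
  have hgi : Integrable g (tilt P X) := by
    have h1 := hG.sub hXi
    have h2 := h1.add (integrable_const (1 + ‖X‖ ^ 2 / 2 - m))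
    refine (h2.const_mul (Real.exp m)).congr (Eventually.of_forall fun ω => ?_)
    simp only [hg, Pi.add_apply, Pi.sub_apply]
    ring
  have hgv : ∫ ω, g ω ∂(tilt P X) = Real.exp m := by
    simp only [hg]
    rw [integral_const_mul]
    have : ∀ ω, 1 + (G ω - X ω + ‖X‖ ^ 2 / 2) - m = (G ω - X ω) + (1 + ‖X‖ ^ 2 / 2 - m) :=
      fun ω => by ring
    simp only [this]
    rw [integral_add (f := fun ω => G ω - X ω) (hG.sub hXi) (integrable_const _),
      integral_sub hG hXi, integral_const, hXm]
    simp only [probReal_univ, one_smul]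
    rw [show ∫ ω, G ω ∂(tilt P X) - ‖X‖ ^ 2 + (1 + ‖X‖ ^ 2 / 2 - m) = 1 by rw [hm]; ring, mul_one]
  have hgP := (integrable_tilt_iff X g).1 hgi
  rw [← hgv, integral_tilt]
  refine (ofReal_integral_le_lintegral_ofReal hgP).trans (lintegral_mono fun ω => ?_)
  refine ENNReal.ofReal_le_ofReal ?_
  set w := G ω - X ω + ‖X‖ ^ 2 / 2 with hw
  have h1 : Real.exp (G ω) = Real.exp (X ω - ‖X‖ ^ 2 / 2) * (Real.exp m * Real.exp (w - m)) := by
    rw [← Real.exp_add, ← Real.exp_add, hw]; ring_nf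
  rw [h1]
  have h2 := Real.add_one_le_exp (w - m)
  have h3 : 1 + w - m ≤ Real.exp (w - m) := by linarith
  simp only [hg]
  gcongr

/-- Only countably many variables occur, so one null set serves for all their measurable versions.
-/
lemma aemeasurable_uncurry_nat {C : ℕ → Ω → ℝ} {Q : Measure Ω} [SFinite Q]
    (hm : ∀ k, AEMeasurable (C k) Q) {μ : Measure ℝ} [SFinite μ] {κ : ℝ → ℕ} (hκ : Measurable κ) :
    AEMeasurable (fun p : ℝ × Ω => C (κ p.1) p.2) (μ.prod Q) := by
  have h1 : ∀ᵐ ω ∂Q, ∀ k : ℕ, C k ω = (hm k).mk _ ω := ae_all_iff.2 fun k => (hm k).ae_eq_mk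
  have h2 := (Measure.quasiMeasurePreserving_snd (μ := μ) (ν := Q)).ae h1
  have h3 : Measurable fun q : ℕ × Ω => (hm q.1).mk _ q.2 :=
    measurable_from_prod_countable_right fun k => (hm k).measurable_mk
  refine ⟨fun p => (hm (κ p.1)).mk _ p.2,
    h3.comp ((hκ.comp measurable_fst).prodMk measurable_snd), ?_⟩
  filter_upwards [h2] with p hp
  exact hp (κ p.1)

/-- Brownian motion, evaluated along a measurable time change, is jointly measurable up to a null
set. -/
lemma aemeasurable_uncurry_brownian (hB : IsBrownianReal B P) {Q : Measure Ω} [SFinite Q]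
    (hQ : Q ≪ P) {μ : Measure ℝ} [SFinite μ] {τ : ℝ → ℝ≥0} (hτ : Measurable τ) :
    AEMeasurable (fun p : ℝ × Ω => B (τ p.1) p.2) (μ.prod Q) := by
  have hm : ∀ σ, AEMeasurable (B σ) Q := fun σ =>
    (hB.toIsPreBrownianReal.aemeasurable σ).mono_ac hQ
  -- The time is rounded down to the grid of mesh `1/(n+1)`; path continuity gives the limit.
  refine aemeasurable_of_tendsto_metrizable_ae' (μ := μ.prod Q)
    (f := fun n p => B (⌊((n : ℝ≥0) + 1) * τ p.1⌋₊ / ((n : ℝ≥0) + 1)) p.2) (fun n => ?_) ?_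
  · have hκ : Measurable fun u => ⌊((n : ℝ≥0) + 1) * τ u⌋₊ :=
      Nat.measurable_floor.comp (hτ.const_mul ((n : ℝ≥0) + 1))
    have h := aemeasurable_uncurry_nat (C := fun k => B (k / ((n : ℝ≥0) + 1)))
      (fun k => hm (k / ((n : ℝ≥0) + 1))) (μ := μ) hκ
    exact h
  · have h1 := (Measure.quasiMeasurePreserving_snd (μ := μ) (ν := Q)).ae (hQ.ae_le hB.cont)
    filter_upwards [h1] with p hp
    refine (hp.tendsto (τ p.1)).comp ?_
    have h2 := (tendsto_nat_floor_mul_div_atTop (R := ℝ) (a := τ p.1) (τ p.1).2).comp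
      (tendsto_natCast_atTop_atTop.comp (tendsto_add_atTop_nat 1))
    refine NNReal.tendsto_coe.1 (h2.congr fun n => ?_)
    simp only [Function.comp_apply, NNReal.coe_div, NNReal.coe_natCast, NNReal.coe_add,
      NNReal.coe_one, Nat.cast_add, Nat.cast_one]
    congr 2
    rw [mul_comm]
    exact Nonneg.nat_floor_coe (((n : ℝ≥0) + 1) * τ p.1)

lemma aemeasurable_uncurry_bridge (hB : IsBrownianReal B P) {Q : Measure Ω} [SFinite Q]
    (hQ : Q ≪ P) {μ : Measure ℝ} [SFinite μ] (lam s y t x : ℝ) :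
    AEMeasurable (fun p : ℝ × Ω => bridge B lam s y t x p.1 p.2) (μ.prod Q) := by
  have h1 := aemeasurable_uncurry_brownian hB hQ (μ := μ) (τ := fun u => (t - u).toNNReal)
    (by fun_prop)
  have h2 := aemeasurable_uncurry_brownian hB hQ (μ := μ) (τ := fun _ => (t - s).toNNReal)
    measurable_const
  unfold bridge
  have h3 : AEMeasurable (fun p : ℝ × Ω => (t - p.1) / (t - s)) (μ.prod Q) :=
    Measurable.aemeasurable (by fun_prop)
  have h4 : AEMeasurable (fun p : ℝ × Ω => ((p.1 - s) * x + (t - p.1) * y) / (t - s)) (μ.prod Q) :=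
    Measurable.aemeasurable (by fun_prop)
  exact ((h1.sub (h3.mul h2)).const_mul _).add h4

/-- The variance of the standard Brownian bridge on `[s,t]`. -/
noncomputable def bridgeVar (s t u : ℝ) : ℝ := (u - s) * (t - u) / (t - s)

lemma bridgeVar_nonneg {s t u : ℝ} (hu : u ∈ Icc s t) : 0 ≤ bridgeVar s t u :=
  div_nonneg (mul_nonneg (by linarith [hu.1]) (by linarith [hu.2])) (by linarith [hu.1, hu.2])

/-- The standard Brownian bridge, run backward in time, as an element of the Gaussian space. -/
noncomputable def bridgeLp (hB : IsPreBrownianReal B P) (s t u : ℝ) : Lp ℝ 2 P :=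
  brownianLp hB (t - u).toNNReal - ((t - u) / (t - s)) • brownianLp hB (t - s).toNNReal

lemma bridgeLp_mem (hB : IsPreBrownianReal B P) (s t u : ℝ) :
    bridgeLp hB s t u ∈ gaussianSpace hB :=
  Submodule.sub_mem _ (brownianLp_mem hB _) (Submodule.smul_mem _ _ (brownianLp_mem hB _))

lemma bridge_ae_eq (hB : IsPreBrownianReal B P) (lam s y t x u : ℝ) :
    bridge B lam s y t x u =ᵐ[P] fun ω => (√lam)⁻¹ * bridgeLp hB s t u ω
      + ((u - s) * x + (t - u) * y) / (t - s) := by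
  filter_upwards [Lp.coeFn_sub (brownianLp hB (t - u).toNNReal)
    (((t - u) / (t - s)) • brownianLp hB (t - s).toNNReal),
    Lp.coeFn_smul ((t - u) / (t - s)) (brownianLp hB (t - s).toNNReal),
    coeFn_brownianLp hB (t - u).toNNReal, coeFn_brownianLp hB (t - s).toNNReal] with ω h1 h2 h3 h4
  rw [bridgeLp, h1, Pi.sub_apply, h2, Pi.smul_apply, h3, h4, bridge, smul_eq_mul]

lemma norm_bridgeLp_sq (hB : IsPreBrownianReal B P) {s t u : ℝ} (hst : s < t) (hu : u ∈ Icc s t) :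
    ‖bridgeLp hB s t u‖ ^ 2 = bridgeVar s t u := by
  have h1 : (t - u).toNNReal ≤ (t - s).toNNReal := Real.toNNReal_le_toNNReal (by linarith [hu.1])
  have h2 : t - s ≠ 0 := by linarith
  rw [bridgeLp, norm_sub_sq_real, norm_smul, mul_pow, real_inner_smul_right,
    ← real_inner_self_eq_norm_sq (brownianLp hB (t - u).toNNReal),
    ← real_inner_self_eq_norm_sq (brownianLp hB (t - s).toNNReal), inner_brownianLp,
    inner_brownianLp, inner_brownianLp, min_self, min_self, min_eq_left h1, Real.coe_toNNReal _ (by linarith [hu.2]),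
    Real.coe_toNNReal _ (by linarith), Real.norm_eq_abs, sq_abs, bridgeVar]
  field_simp
  ring

/-- The law of the bridge under the tilted measure. -/
lemma map_bridge_tilt (hB : IsPreBrownianReal B P) {X : Lp ℝ 2 P} (hX : X ∈ gaussianSpace hB)
    {lam s t u : ℝ} (hlam : 0 < lam) (hst : s < t) (hu : u ∈ Icc s t) (y x : ℝ) :
    (tilt P X).map (bridge B lam s y t x u)
      = gaussianReal ((√lam)⁻¹ * ⟪X, bridgeLp hB s t u⟫ + ((u - s) * x + (t - u) * y) / (t - s))
        (bridgeVar s t u / lam).toNNReal := by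
  have hY := bridgeLp_mem hB s t u
  have hm : AEMeasurable (bridgeLp hB s t u) (tilt P X) :=
    (Lp.aestronglyMeasurable _).aemeasurable.mono_ac (tilt_absolutelyContinuous X)
  have h1 : HasLaw (bridgeLp hB s t u) (gaussianReal ⟪X, bridgeLp hB s t u⟫
      (‖bridgeLp hB s t u‖₊ ^ 2)) (tilt P X) := ⟨hm, map_tilt_eq_gaussianReal hB hX hY⟩
  have h2 := gaussianReal_add_const (gaussianReal_const_mul h1 (√lam)⁻¹)
    (((u - s) * x + (t - u) * y) / (t - s))
  rw [Measure.map_congr ((tilt_absolutelyContinuous X).ae_le (bridge_ae_eq hB lam s y t x u)),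
    h2.map_eq]
  congr 1
  ext
  rw [Real.coe_toNNReal _ (div_nonneg (bridgeVar_nonneg hu) hlam.le), NNReal.coe_mul,
    NNReal.coe_pow, coe_nnnorm, norm_bridgeLp_sq hB hst hu]
  simp only [NNReal.coe_mk, inv_pow, Real.sq_sqrt hlam.le]
  field_simp

end LowerTail

/-! ### Lower bounds for the Feynman–Kac expectation along a single path. -/

namespace LowerTail

open scoped RealInnerProductSpace

variable {Ω : Type*} [MeasurableSpace Ω] {P : Measure Ω} {B : ℝ≥0 → Ω → ℝ}

/-- A lower bound for the Feynman–Kac expectation through a Gaussian change of measure. -/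
lemma le_FK_of_mem (hB : IsBrownianReal B P) {X : Lp ℝ 2 P}
    (hX : X ∈ gaussianSpace hB.toIsPreBrownianReal) {lam s t : ℝ} (hlam : 0 < lam) (hst : s < t)
    (y x : ℝ) {m : ℝ → ℝ}
    (hm : ∀ u ∈ Icc s t, (√lam)⁻¹ * ⟪X, bridgeLp hB.toIsPreBrownianReal s t u⟫
      + ((u - s) * x + (t - u) * y) / (t - s) = m u)
    {ρ : ℝ × ℝ → ℝ} (hρ : Measurable ρ) {c : ℝ → ℝ} (hc : IntervalIntegrable c volume s t)
    (hE : ∫⁻ u in Ioc s t, ∫⁻ z, ‖ρ (u, z) - c u‖ₑ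
      ∂(gaussianReal (m u) (bridgeVar s t u / lam).toNNReal) ≠ ∞) :
    ENNReal.ofReal (Real.exp (lam * ((∫ u in s..t, c u) - (∫⁻ u in Ioc s t,
      ∫⁻ z, ‖ρ (u, z) - c u‖ₑ ∂(gaussianReal (m u) (bridgeVar s t u / lam).toNNReal)).toReal)
      - ‖X‖ ^ 2 / 2)) ≤ FK P B lam ρ s y t x := by
  set Q := tilt P X with hQ
  have hQp : IsProbabilityMeasure Q := isProbabilityMeasure_tilt hB.toIsPreBrownianReal hX
  have hQP : Q ≪ P := tilt_absolutelyContinuous X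
  set μ := (volume : Measure ℝ).restrict (Ioc s t) with hμ
  have hcμ : Integrable c μ := (intervalIntegrable_iff_integrableOn_Ioc_of_le hst.le).1 hc
  set W : ℝ × Ω → ℝ := fun p => bridge B lam s y t x p.1 p.2 with hW
  have hWm : AEMeasurable W (μ.prod Q) := aemeasurable_uncurry_bridge hB hQP lam s y t x
  set F : ℝ × Ω → ℝ := fun p => ρ (p.1, W p) - c p.1 with hF
  have hFm : AEStronglyMeasurable F (μ.prod Q) :=
    (hρ.comp_aemeasurable (measurable_fst.aemeasurable.prodMk hWm)).aestronglyMeasurable.sub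
      (hcμ.comp_fst Q).aestronglyMeasurable
  set E := ∫⁻ u in Ioc s t, ∫⁻ z, ‖ρ (u, z) - c u‖ₑ
      ∂(gaussianReal (m u) (bridgeVar s t u / lam).toNNReal) with hEdef
  have hEF : ∫⁻ p, ‖F p‖ₑ ∂(μ.prod Q) = E := by
    rw [lintegral_prod _ hFm.enorm, hEdef]
    refine lintegral_congr_ae ?_
    filter_upwards [ae_restrict_mem measurableSet_Ioc] with u hu
    have hu' : u ∈ Icc s t := Ioc_subset_Icc_self hu
    have hlaw := map_bridge_tilt hB.toIsPreBrownianReal hX hlam hst hu' y x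
    rw [hm u hu'] at hlaw
    have hWu : AEMeasurable (bridge B lam s y t x u) Q := by
      have h1 := (hB.toIsPreBrownianReal.aemeasurable (t - u).toNNReal).mono_ac hQP
      have h2 := (hB.toIsPreBrownianReal.aemeasurable (t - s).toNNReal).mono_ac hQP
      unfold bridge
      fun_prop
    have h3 : Measurable fun z => ‖ρ (u, z) - c u‖ₑ :=
      ((hρ.comp measurable_prodMk_left).sub_const _).enorm
    rw [← hlaw, lintegral_map' h3.aemeasurable hWu]
  have hFi : Integrable F (μ.prod Q) := ⟨hFm, by
    rw [HasFiniteIntegral, hEF]; exact hE.lt_top⟩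
  have hnorm : |∫ p, F p ∂(μ.prod Q)| ≤ E.toReal := by
    rw [← hEF, ← integral_norm_eq_lintegral_enorm hFm]
    exact norm_integral_le_integral_norm F
  set G : Ω → ℝ := fun ω => ∫ u in s..t, lam * ρ (u, bridge B lam s y t x u ω) with hG
  -- Fubini makes `F` integrable in time for almost every `ω`, which is what allows the time
  -- integral to be split.
  have hGae : G =ᵐ[Q] fun ω => lam * (∫ u, F (u, ω) ∂μ) + lam * ∫ u, c u ∂μ := by
    filter_upwards [hFi.prod_left_ae] with ω hω
    rw [hG, ← mul_add, ← integral_add hω hcμ]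
    simp only
    rw [intervalIntegral.integral_const_mul, intervalIntegral.integral_of_le hst.le]
    congr 1
    refine integral_congr_ae (Eventually.of_forall fun u => ?_)
    simp [hF, hW]
  have hI1 : Integrable (fun ω => lam * (∫ u, F (u, ω) ∂μ)) Q :=
    hFi.integral_prod_right.const_mul lam
  have hGi : Integrable G Q := (hI1.add (integrable_const _)).congr hGae.symm
  have hGv : ∫ ω, G ω ∂Q = lam * (∫ p, F p ∂(μ.prod Q)) + lam * ∫ u, c u ∂μ := by
    rw [integral_congr_ae hGae, integral_add hI1 (integrable_const _), integral_const_mul,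
      integral_prod_symm F hFi, integral_const]
    simp
  refine le_trans ?_ (exp_le_lintegral_exp hB.toIsPreBrownianReal hX hGi)
  refine ENNReal.ofReal_le_ofReal (Real.exp_le_exp.2 ?_)
  rw [hGv, intervalIntegral.integral_of_le hst.le]
  have h1 := (abs_le.1 hnorm).1
  nlinarith

/-- The lower bound for the Feynman–Kac expectation given by a path with derivative `f`. -/
lemma le_FK (hB : IsBrownianReal B P) {lam s t : ℝ} (hlam : 0 < lam) (hst : s < t)
    {y x : ℝ} {f γ : ℝ → ℝ} (hf : MemLp f 2 (volume.restrict (Ioc s t)))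
    (hγ : ∀ u ∈ Icc s t, γ u = y + ∫ w in s..u, f w) (hγt : γ t = x)
    {ρ : ℝ × ℝ → ℝ} (hρ : Measurable ρ) {c : ℝ → ℝ} (hc : IntervalIntegrable c volume s t)
    (hE : ∫⁻ u in Ioc s t, ∫⁻ z, ‖ρ (u, z) - c u‖ₑ
      ∂(gaussianReal (γ u) (bridgeVar s t u / lam).toNNReal) ≠ ∞) :
    ENNReal.ofReal (Real.exp (lam * ((∫ u in s..t, c u) - (∫⁻ u in Ioc s t,
      ∫⁻ z, ‖ρ (u, z) - c u‖ₑ ∂(gaussianReal (γ u) (bridgeVar s t u / lam).toNNReal)).toReal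
      - ((∫ u in s..t, f u ^ 2) / 2 - (y - x) ^ 2 / (2 * (t - s))))))
      ≤ FK P B lam ρ s y t x := by
  have hts : t - s ≠ 0 := by linarith
  set v := (x - y) / (t - s) with hv
  have hf1 : IntervalIntegrable f volume s t :=
    (intervalIntegrable_iff_integrableOn_Ioc_of_le hst.le).2
      (memLp_one_iff_integrable.1 (hf.mono_exponent (by norm_num)))
  have hf2 : IntervalIntegrable (fun u => f u ^ 2) volume s t :=
    (intervalIntegrable_iff_integrableOn_Ioc_of_le hst.le).2 hf.integrable_sq
  -- The chord is `x - v(t-u)`, and `∫_u^t (v - f) = v(t-u) - (x - γ u)` is exactly what takes it to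
  -- `γ u`. This integral vanishes at `u = s`, so the bridge correction contributes nothing, and `∫
  -- (v-f)² = ∫ f² - (x-y)²/(t-s)`.
  have hg : MemLp (fun u => v - f u) 2 (volume.restrict (Ioc s t)) := (memLp_const v).sub hf
  obtain ⟨X, hX, hXi, hXn⟩ := exists_wiener hB.toIsPreBrownianReal hg hst.le
  have hfx : ∫ w in s..t, f w = x - y := by
    have := hγ t ⟨hst.le, le_rfl⟩; linarith
  have hfu : ∀ u ∈ Icc s t, ∫ w in u..t, f w = x - γ u := by
    intro u hu
    have h1 : IntervalIntegrable f volume s u := hf1.mono_set (by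
      rw [uIcc_of_le hu.1, uIcc_of_le hst.le]; exact Icc_subset_Icc_right hu.2)
    have h2 := intervalIntegral.integral_interval_sub_left hf1 h1
    rw [← h2, hfx, hγ u hu]; ring
  have hI : ∀ u ∈ Icc s t, ∫ w in u..t, (v - f w) = v * (t - u) - (x - γ u) := by
    intro u hu
    have h1 : IntervalIntegrable f volume u t := hf1.mono_set (by
      rw [uIcc_of_le hu.2, uIcc_of_le hst.le]; exact Icc_subset_Icc_left hu.1)
    rw [intervalIntegral.integral_sub (by simp) h1, hfu u hu, intervalIntegral.integral_const,
      smul_eq_mul]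
    ring
  have hγs : γ s = y := by
    have := hγ s ⟨le_rfl, hst.le⟩; simpa using this
  have hsq : 0 < √lam := Real.sqrt_pos.2 hlam
  have hm : ∀ u ∈ Icc s t, (√lam)⁻¹ * ⟪√lam • X, bridgeLp hB.toIsPreBrownianReal s t u⟫
      + ((u - s) * x + (t - u) * y) / (t - s) = γ u := by
    intro u hu
    rw [real_inner_smul_left, ← mul_assoc, inv_mul_cancel₀ hsq.ne', one_mul, bridgeLp,
      inner_sub_right, real_inner_smul_right, hXi u hu, hXi s ⟨le_rfl, hst.le⟩, hI u hu,
      hI s ⟨le_rfl, hst.le⟩, hγs, hv]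
    field_simp
    ring
  refine le_trans (ENNReal.ofReal_le_ofReal (Real.exp_le_exp.2 ?_))
    (le_FK_of_mem hB (Submodule.smul_mem _ (√lam) hX) hlam hst y x hm hρ hc hE)
  have hn : ‖√lam • X‖ ^ 2 = lam * ‖X‖ ^ 2 := by
    rw [norm_smul, mul_pow, Real.norm_eq_abs, sq_abs, Real.sq_sqrt hlam.le]
  have hsqint : ∫ w in s..t, (v - f w) ^ 2 = (∫ u in s..t, f u ^ 2) - (y - x) ^ 2 / (t - s) := by
    have h1 : ∀ w, (v - f w) ^ 2 = (v ^ 2 - 2 * v * f w) + f w ^ 2 := fun w => by ring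
    simp only [h1]
    rw [intervalIntegral.integral_add (((by simp : IntervalIntegrable (fun _ => v ^ 2) volume s t)).sub
      (hf1.const_mul _)) hf2, intervalIntegral.integral_sub (by simp) (hf1.const_mul _),
      intervalIntegral.integral_const, intervalIntegral.integral_const_mul, hfx, hv, smul_eq_mul]
    field_simp
    ring
  rw [hsqint] at hXn
  rw [hn]
  have h3 : (y - x) ^ 2 / (2 * (t - s)) = (y - x) ^ 2 / (t - s) / 2 := by field_simp
  rw [h3]
  nlinarith

/-- The Feynman–Kac expectation depends on `ρ` only up to null sets. -/
lemma FK_congr_ae (hB : IsBrownianReal B P) {lam s t : ℝ} (hlam : 0 < lam) (hs : 0 ≤ s)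
    (hst : s < t) (ht : t ≤ 2) (y x : ℝ) {ρ ρ' : ℝ × ℝ → ℝ} (h : ρ =ᵐ[stripMeasure] ρ') :
    FK P B lam ρ s y t x = FK P B lam ρ' s y t x := by
  have hP := hB.isGaussianProcess.isProbabilityMeasure
  set μ := (volume : Measure ℝ).restrict (Ioc s t) with hμ
  have hstrip : μ.prod (volume : Measure ℝ) ≤ stripMeasure := by
    rw [stripMeasure, Measure.volume_eq_prod, ← Measure.prod_restrict, Measure.restrict_univ]
    have hsub : Ioc s t ⊆ Icc 0 2 := fun u hu => ⟨hs.trans hu.1.le, hu.2.trans ht⟩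
    exact Measure.prod_mono (Measure.restrict_mono hsub le_rfl) le_rfl
  have h1 : ∀ᵐ p ∂(μ.prod (volume : Measure ℝ)), ρ p = ρ' p := ae_mono hstrip h
  obtain ⟨N, hNsub, hNm, hN0⟩ := exists_measurable_superset_of_null (ae_iff.1 h1)
  have hWm : AEMeasurable (fun p : ℝ × Ω => bridge B lam s y t x p.1 p.2) (μ.prod P) :=
    aemeasurable_uncurry_bridge hB Measure.AbsolutelyContinuous.rfl lam s y t x
  have h0 : (0 : Lp ℝ 2 P) ∈ gaussianSpace hB.toIsPreBrownianReal := Submodule.zero_mem _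
  -- Tilting by `0` changes nothing, so `map_bridge_tilt` also gives the law of the untilted bridge.
  have htilt : tilt P (0 : Lp ℝ 2 P) = P := by
    rw [tilt]
    conv_rhs => rw [← withDensity_one (μ := P)]
    refine withDensity_congr_ae ?_
    filter_upwards [Lp.coeFn_zero ℝ 2 P] with ω hω
    rw [hω]
    simp
  have hNu : ∀ᵐ u ∂μ, (volume : Measure ℝ) (Prod.mk u ⁻¹' N) = 0 :=
    (Measure.measure_prod_null hNm).1 hN0
  have hW1 : ∀ᵐ u ∂μ, ∀ᵐ ω ∂P, (u, bridge B lam s y t x u ω) ∉ N := by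
    filter_upwards [hNu, ae_restrict_mem measurableSet_Ioc,
      ae_restrict_of_ae (ae_ne_point t)] with u hu hut hne
    have hu' : u ∈ Icc s t := Ioc_subset_Icc_self hut
    have hlaw := map_bridge_tilt hB.toIsPreBrownianReal h0 hlam hst hu' y x
    rw [htilt] at hlaw
    -- Excluding `u = t` matters: the law there is a point mass and may charge a Lebesgue null set.
    have hvar : (bridgeVar s t u / lam).toNNReal ≠ 0 := by
      have hlt : u < t := lt_of_le_of_ne hut.2 hne
      have : 0 < bridgeVar s t u / lam := by
        refine div_pos (div_pos (mul_pos ?_ ?_) ?_) hlam <;> linarith [hut.1]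
      exact (Real.toNNReal_pos.2 this).ne'
    have hn := gaussianReal_absolutelyContinuous ((√lam)⁻¹ * ⟪(0 : Lp ℝ 2 P),
      bridgeLp hB.toIsPreBrownianReal s t u⟫ + ((u - s) * x + (t - u) * y) / (t - s)) hvar hu
    rw [← hlaw] at hn
    have hWu : AEMeasurable (bridge B lam s y t x u) P := by
      have h1 := hB.toIsPreBrownianReal.aemeasurable (t - u).toNNReal
      have h2 := hB.toIsPreBrownianReal.aemeasurable (t - s).toNNReal
      unfold bridge
      fun_prop
    rw [Measure.map_apply_of_aemeasurable hWu (measurable_prodMk_left hNm)] at hn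
    rw [ae_iff]
    simpa [preimage] using hn
  -- Passing from sections to the product needs a measurable set, hence the measurable version of
  -- the bridge.
  have hW2 : ∀ᵐ p ∂(μ.prod P), (p.1, hWm.mk _ p) ∉ N := by
    have hmeas : Measurable fun p : ℝ × Ω => (p.1, hWm.mk _ p) :=
      measurable_fst.prodMk hWm.measurable_mk
    refine (Measure.ae_prod_iff_ae_ae (p := fun p => (p.1, hWm.mk _ p) ∉ N)
      (hmeas hNm.compl)).2 ?_
    filter_upwards [hW1, Measure.ae_ae_of_ae_prod hWm.ae_eq_mk] with u h2 h3
    filter_upwards [h2, h3] with ω h4 h5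
    rwa [← h5]
  have hW3 : ∀ᵐ p ∂(μ.prod P), (p.1, bridge B lam s y t x p.1 p.2) ∉ N := by
    filter_upwards [hW2, hWm.ae_eq_mk] with p h2 h3
    rwa [h3]
  have hW4 := Measure.ae_ae_of_ae_prod
    ((Measure.measurePreserving_swap (μ := P) (ν := μ)).quasiMeasurePreserving.ae hW3)
  refine lintegral_congr_ae ?_
  filter_upwards [hW4] with ω hω
  congr 2
  rw [intervalIntegral.integral_of_le hst.le, intervalIntegral.integral_of_le hst.le]
  refine integral_congr_ae ?_
  filter_upwards [hω] with u hu
  have : ρ (u, bridge B lam s y t x u ω) = ρ' (u, bridge B lam s y t x u ω) := by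
    by_contra hne
    exact hu (hNsub hne)
  simp only [this]

end LowerTail

namespace LowerTail

/-! ### Gaussian integrals -/

/-- Moving mean and variance from the measure into the integrand makes measurability in these
parameters, and bounds in terms of `√v`, accessible. -/
lemma lintegral_gaussianReal {k : ℝ → ℝ≥0∞} (hk : Measurable k) (m : ℝ) (v : ℝ≥0) :
    ∫⁻ z, k z ∂(gaussianReal m v) = ∫⁻ w, k (m + √v * w) ∂(gaussianReal 0 1) := by
  have h : gaussianReal m v = (gaussianReal 0 1).map (fun w => m + √v * w) := by
    have h1 := gaussianReal_map_const_mul (μ := 0) (v := 1) (√v)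
    have h2 := gaussianReal_map_const_add (μ := √v * 0) (v := NNReal.mk (√v ^ 2) (sq_nonneg _) * 1) m
    rw [← h1, Measure.map_map (by fun_prop) (by fun_prop)] at h2
    have h3 : NNReal.mk (√v ^ 2) (sq_nonneg _) * 1 = v := by
      ext; simp
    rw [h3, mul_zero, zero_add] at h2
    rw [← h2]
    rfl
  rw [h, lintegral_map hk (by fun_prop)]

/-- Averaging the mean of a Gaussian over another Gaussian. -/
lemma lintegral_lintegral_gaussianReal {k : ℝ → ℝ≥0∞} (hk : Measurable k) (m p : ℝ)
    (v w : ℝ≥0) :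
    ∫⁻ a, ∫⁻ z, k z ∂(gaussianReal (m + a * p) v) ∂(gaussianReal 0 w)
      = ∫⁻ z, k z ∂(gaussianReal m (v + NNReal.mk (p ^ 2) (sq_nonneg p) * w)) := by
  have h1 : (gaussianReal 0 w).map (fun a => m + p * a)
      = gaussianReal m (NNReal.mk (p ^ 2) (sq_nonneg p) * w) := by
    have h1 := gaussianReal_map_const_mul (μ := 0) (v := w) p
    have h2 := gaussianReal_map_const_add (μ := p * 0) (v := NNReal.mk (p ^ 2) (sq_nonneg p) * w) m
    rw [← h1, Measure.map_map (by fun_prop) (by fun_prop)] at h2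
    rw [mul_zero, zero_add] at h2
    rw [← h2]
    rfl
  have h2 : ∀ a, ∫⁻ z, k z ∂(gaussianReal (m + a * p) v)
      = ∫⁻ z, k ((m + p * a) + z) ∂(gaussianReal 0 v) := by
    intro a
    rw [← lintegral_map (f := k) (g := fun z => (m + p * a) + z) hk (by fun_prop),
      gaussianReal_map_const_add, zero_add, mul_comm a p]
  have hm : Measurable fun q : ℝ => ∫⁻ z, k (q + z) ∂(gaussianReal 0 v) :=
    Measurable.lintegral_prod_right' (f := fun x : ℝ × ℝ => k (x.1 + x.2))
      (hk.comp (measurable_fst.add measurable_snd))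
  simp only [h2]
  rw [← lintegral_map (f := fun q => ∫⁻ z, k (q + z) ∂(gaussianReal 0 v))
    (g := fun a => m + p * a) hm (by fun_prop), h1, ← Measure.lintegral_conv hk,
    gaussianReal_conv_gaussianReal, add_zero, add_comm v]

lemma lintegral_abs_gaussianReal_le :
    ∫⁻ w, ENNReal.ofReal |w| ∂(gaussianReal 0 1) ≤ 1 := by
  have hsq : Integrable (fun w : ℝ => w ^ 2) (gaussianReal 0 1) :=
    (memLp_id_gaussianReal 2).integrable_sq
  have hv : ∫ w, w ^ 2 ∂(gaussianReal 0 1) = 1 := by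
    have h := variance_id_gaussianReal (μ := 0) (v := 1)
    rw [variance_eq_sub (memLp_id_gaussianReal 2)] at h
    simpa [integral_id_gaussianReal] using h
  have hi : Integrable (fun w : ℝ => (1 + w ^ 2) / 2) (gaussianReal 0 1) :=
    ((integrable_const 1).add hsq).div_const 2
  calc ∫⁻ w, ENNReal.ofReal |w| ∂(gaussianReal 0 1)
      ≤ ∫⁻ w, ENNReal.ofReal ((1 + w ^ 2) / 2) ∂(gaussianReal 0 1) := by
        refine lintegral_mono fun w => ENNReal.ofReal_le_ofReal ?_
        nlinarith [sq_nonneg (|w| - 1), sq_abs w]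
    _ = ENNReal.ofReal (∫ w, (1 + w ^ 2) / 2 ∂(gaussianReal 0 1)) :=
        (ofReal_integral_eq_lintegral_ofReal hi (Eventually.of_forall fun w => by positivity)).symm
    _ = 1 := by
        rw [integral_div, integral_add (integrable_const 1) hsq, hv]
        simp

lemma gaussianPDF_le {m : ℝ} {v : ℝ≥0} {σ : ℝ} (hσ : 0 < σ) (hv : σ ^ 2 ≤ v) (z : ℝ) :
    gaussianPDF m v z ≤ ENNReal.ofReal σ⁻¹ := by
  refine ENNReal.ofReal_le_ofReal ?_
  rw [gaussianPDFReal]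
  have h1 : σ ≤ √(2 * Real.pi * v) := by
    refine Real.le_sqrt_of_sq_le ?_
    have := Real.pi_gt_three
    have h0 : (0 : ℝ) ≤ v := v.2
    nlinarith
  have h2 : Real.exp (-(z - m) ^ 2 / (2 * v)) ≤ 1 := by
    rw [Real.exp_le_one_iff]
    exact div_nonpos_of_nonpos_of_nonneg (by nlinarith [sq_nonneg (z - m)]) (by positivity)
  calc _ ≤ (√(2 * Real.pi * v))⁻¹ * 1 := by gcongr
    _ ≤ σ⁻¹ := by rw [mul_one]; gcongr

/-- A weighted bound on a Gaussian average by an integral against Lebesgue measure. -/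
lemma lintegral_enorm_gaussianReal_le {q : ℝ → ℝ} (hq : Measurable q) {m σ k : ℝ} {v : ℝ≥0}
    (hσ : 0 < σ) (hk : 0 < k) (hv : σ ^ 2 ≤ v) :
    ∫⁻ z, ‖q z‖ₑ ∂(gaussianReal m v)
      ≤ ENNReal.ofReal k * (∫⁻ z, ‖q z‖ₑ ^ 2) + ENNReal.ofReal (k⁻¹ * σ⁻¹) := by
  have hv0 : v ≠ 0 := by
    rintro rfl
    have : 0 < σ ^ 2 := by positivity
    simp at hv
    linarith
  -- This is `|q| ≤ A q² + 1/A` with `A = kσ`; the factor `σ` is chosen to cancel the density bound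
  -- `1/σ`.
  have h1 : ∀ z, ‖q z‖ₑ ≤ ENNReal.ofReal (k * σ) * ‖q z‖ₑ ^ 2 + ENNReal.ofReal (k⁻¹ * σ⁻¹) := by
    intro z
    rw [Real.enorm_eq_ofReal_abs, ← ENNReal.ofReal_pow (abs_nonneg _), ← ENNReal.ofReal_mul
      (by positivity), ← ENNReal.ofReal_add (by positivity) (by positivity)]
    refine ENNReal.ofReal_le_ofReal ?_
    rw [← mul_inv]
    set A := k * σ with hA
    have hA0 : 0 < A := by positivity
    have : 0 ≤ (A * |q z| - 1) ^ 2 := sq_nonneg _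
    have h3 : A * (A * |q z| ^ 2 + A⁻¹ - |q z|) = (A * |q z|) ^ 2 + 1 - A * |q z| := by
      field_simp
    have h4 : 0 ≤ A * (A * |q z| ^ 2 + A⁻¹ - |q z|) := by
      rw [h3]; nlinarith [sq_nonneg (A * |q z|)]
    have := nonneg_of_mul_nonneg_right h4 hA0
    linarith
  have hm2 : Measurable fun z => ‖q z‖ₑ ^ 2 := hq.enorm.pow_const 2
  calc ∫⁻ z, ‖q z‖ₑ ∂(gaussianReal m v)
      ≤ ∫⁻ z, (ENNReal.ofReal (k * σ) * ‖q z‖ₑ ^ 2 + ENNReal.ofReal (k⁻¹ * σ⁻¹))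
          ∂(gaussianReal m v) := lintegral_mono h1
    _ = ENNReal.ofReal (k * σ) * (∫⁻ z, ‖q z‖ₑ ^ 2 ∂(gaussianReal m v))
          + ENNReal.ofReal (k⁻¹ * σ⁻¹) := by
        rw [lintegral_add_right _ measurable_const, lintegral_const_mul _ hm2, lintegral_const,
          measure_univ, mul_one]
    _ ≤ ENNReal.ofReal (k * σ) * (ENNReal.ofReal σ⁻¹ * ∫⁻ z, ‖q z‖ₑ ^ 2)
          + ENNReal.ofReal (k⁻¹ * σ⁻¹) := by
        gcongr
        rw [gaussianReal_of_var_ne_zero _ hv0, lintegral_withDensity_eq_lintegral_mul _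
          (measurable_gaussianPDF m v) hm2, ← lintegral_const_mul _ hm2]
        refine lintegral_mono fun z => ?_
        exact mul_le_mul_left (gaussianPDF_le hσ hv z) _
    _ = ENNReal.ofReal k * (∫⁻ z, ‖q z‖ₑ ^ 2) + ENNReal.ofReal (k⁻¹ * σ⁻¹) := by
        rw [← mul_assoc, ← ENNReal.ofReal_mul (by positivity)]
        congr 3
        field_simp

/-- Gaussian average of the spatial modulus of continuity of `rhoLim`. -/
lemma lintegral_enorm_rhoLim_sub_le {u : ℝ} (hu : u ∈ Ioo (0 : ℝ) 2) (m : ℝ) {v : ℝ≥0} {η : ℝ}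
    (hη : √v ≤ η) :
    ∫⁻ z, ‖rhoLim (u, z) - rhoLim (u, m)‖ₑ ∂(gaussianReal m v)
      ≤ ENNReal.ofReal (min (r u) (r u ^ 2 * η)) := by
  have hm : Measurable fun z => ‖rhoLim (u, z) - rhoLim (u, m)‖ₑ :=
    ((measurable_rhoLim.comp measurable_prodMk_left).sub_const _).enorm
  have h0 : ∀ z, ‖rhoLim (u, z) - rhoLim (u, m)‖ₑ
      ≤ ENNReal.ofReal (min (r u) (r u ^ 2 * |z - m|)) := fun z => by
    rw [Real.enorm_eq_ofReal_abs]
    exact ENNReal.ofReal_le_ofReal (abs_rhoLim_sub_le hu z m)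
  have hη0 : 0 ≤ η := (Real.sqrt_nonneg _).trans hη
  rw [(ENNReal.ofReal_mono : Monotone ENNReal.ofReal).map_min]
  refine le_min ?_ ?_
  · calc _ ≤ ∫⁻ _, ENNReal.ofReal (r u) ∂(gaussianReal m v) :=
          lintegral_mono fun z => (h0 z).trans (ENNReal.ofReal_le_ofReal (min_le_left _ _))
      _ = _ := by simp
  · rw [lintegral_gaussianReal hm]
    calc _ ≤ ∫⁻ w, ENNReal.ofReal (r u ^ 2 * η) * ENNReal.ofReal |w| ∂(gaussianReal 0 1) := by
          refine lintegral_mono fun w => (h0 _).trans ?_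
          rw [← ENNReal.ofReal_mul (by positivity)]
          refine ENNReal.ofReal_le_ofReal ((min_le_right _ _).trans ?_)
          rw [add_sub_cancel_left, abs_mul, abs_of_nonneg (Real.sqrt_nonneg _), mul_assoc]
          gcongr
      _ = ENNReal.ofReal (r u ^ 2 * η) * ∫⁻ w, ENNReal.ofReal |w| ∂(gaussianReal 0 1) :=
          lintegral_const_mul _ (by fun_prop)
      _ ≤ ENNReal.ofReal (r u ^ 2 * η) * 1 := by gcongr; exact lintegral_abs_gaussianReal_le
      _ = _ := mul_one _

/-- The time integral of the modulus of continuity of `rhoLim`. -/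
noncomputable def modulus (η : ℝ) : ℝ≥0∞ :=
  ∫⁻ u in Ioo (0 : ℝ) 2, ENNReal.ofReal (min (r u) (r u ^ 2 * η))

lemma modulus_mono {η η' : ℝ} (h : η ≤ η') : modulus η ≤ modulus η' := by
  refine lintegral_mono fun u => ENNReal.ofReal_le_ofReal ?_
  gcongr

/-- Dominated convergence applies: the integrand is at most `r`, which is integrable, and tends to
`0` pointwise on `(0,2)`. -/
lemma tendsto_modulus : Tendsto modulus (𝓝[>] 0) (𝓝 0) := by
  set R := (Ioo (0 : ℝ) 2).indicator r with hR
  have he : modulus = fun η => ∫⁻ u in Ioo (0 : ℝ) 2, ENNReal.ofReal (min (R u) (R u ^ 2 * η)) := by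
    ext η
    refine setLIntegral_congr_fun measurableSet_Ioo fun u hu => ?_
    simp only [hR, indicator_of_mem hu]
  have h : Tendsto modulus (𝓝[>] 0) (𝓝 (∫⁻ u in Ioo (0 : ℝ) 2, 0)) := by
    rw [he]
    refine tendsto_lintegral_filter_of_dominated_convergence
      (fun u => ENNReal.ofReal (R u)) ?_ ?_ ?_ ?_
    · refine Eventually.of_forall fun η => ?_
      have := measurable_indicator_r
      exact (this.min ((this.pow_const 2).mul_const η)).ennreal_ofReal
    · exact Eventually.of_forall fun η => Eventually.of_forall fun u =>
        ENNReal.ofReal_le_ofReal (min_le_left _ _)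
    · exact integrable_indicator_r.integrableOn.lintegral_lt_top.ne
    · filter_upwards [ae_restrict_mem measurableSet_Ioo] with u hu
      have h1 : Tendsto (fun η : ℝ => min (R u) (R u ^ 2 * η)) (𝓝 0) (𝓝 (min (R u) (R u ^ 2 * 0))) :=
        (by fun_prop : Continuous fun η : ℝ => min (R u) (R u ^ 2 * η)).tendsto 0
      have h2 : 0 ≤ R u := by simp only [hR, indicator_of_mem hu, (r_pos hu).le]
      rw [mul_zero, min_eq_right h2] at h1
      have := (ENNReal.tendsto_ofReal h1).mono_left (nhdsWithin_le_nhds (s := Ioi 0))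
      simpa using this
  simpa using h

/-! ### The direction in which paths are spread out -/

/-- The function `b^{3/4}`, with `b` the variance of the Brownian bridge. -/
noncomputable def spread (s t u : ℝ) : ℝ := bridgeVar s t u ^ (3 / 4 : ℝ)

/-- The derivative of `spread`. -/
noncomputable def spreadDeriv (s t u : ℝ) : ℝ :=
  (t + s - 2 * u) / (t - s) * (3 / 4) * bridgeVar s t u ^ (-(1 / 4) : ℝ)

lemma bridgeVar_pos {s t u : ℝ} (hu : u ∈ Ioo s t) : 0 < bridgeVar s t u :=
  div_pos (mul_pos (by linarith [hu.1]) (by linarith [hu.2])) (by linarith [hu.1, hu.2])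

lemma inv_bridgeVar {s t u : ℝ} (hu : u ∈ Ioo s t) :
    (bridgeVar s t u)⁻¹ = (u - s)⁻¹ + (t - u)⁻¹ := by
  have h1 : u - s ≠ 0 := by linarith [hu.1]
  have h2 : t - u ≠ 0 := by linarith [hu.2]
  rw [bridgeVar]
  field_simp
  ring

lemma bridgeVar_le {s t u : ℝ} (hu : u ∈ Icc s t) : bridgeVar s t u ≤ t - s := by
  rcases eq_or_lt_of_le (hu.1.trans hu.2) with h | h
  · subst h; simp [bridgeVar]
  · rw [bridgeVar, div_le_iff₀ (by linarith)]
    have := hu.1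
    have := hu.2
    apply mul_le_mul <;> linarith

lemma continuous_bridgeVar (s t : ℝ) : Continuous (bridgeVar s t) := by
  unfold bridgeVar; fun_prop

lemma continuous_spread (s t : ℝ) : Continuous (spread s t) :=
  (continuous_bridgeVar s t).rpow_const fun _ => Or.inr (by norm_num)

lemma measurable_spreadDeriv (s t : ℝ) : Measurable (spreadDeriv s t) := by
  have := (continuous_bridgeVar s t).measurable
  unfold spreadDeriv
  fun_prop

lemma spread_left (s t : ℝ) : spread s t s = 0 := by
  simp [spread, bridgeVar, Real.zero_rpow (show (3 / 4 : ℝ) ≠ 0 by norm_num)]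

lemma spread_right (s t : ℝ) : spread s t t = 0 := by
  simp [spread, bridgeVar, Real.zero_rpow (show (3 / 4 : ℝ) ≠ 0 by norm_num)]

lemma spread_pos {s t u : ℝ} (hu : u ∈ Ioo s t) : 0 < spread s t u :=
  Real.rpow_pos_of_pos (bridgeVar_pos hu) _

lemma hasDerivAt_spread {s t u : ℝ} (hu : u ∈ Ioo s t) :
    HasDerivAt (spread s t) (spreadDeriv s t u) u := by
  have h1 : HasDerivAt (bridgeVar s t) ((t + s - 2 * u) / (t - s)) u := by
    have h := (((hasDerivAt_id u).sub_const s).mul ((hasDerivAt_id u).const_sub t)).div_const (t - s)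
    refine h.congr_deriv ?_
    simp only [id]
    ring
  have h2 := h1.rpow_const (p := 3 / 4) (Or.inl (bridgeVar_pos hu).ne')
  refine h2.congr_deriv ?_
  rw [spreadDeriv]
  norm_num

/-- Since `1/b = 1/(u-s) + 1/(t-u)` and `z ↦ z^p` is subadditive for `0 ≤ p ≤ 1`, the singularities
at the two endpoints separate. -/
lemma rpow_bridgeVar_le {s t u p : ℝ} (hu : u ∈ Ioo s t) (hp : 0 ≤ p) (hp1 : p ≤ 1) :
    bridgeVar s t u ^ (-p) ≤ (u - s) ^ (-p) + (t - u) ^ (-p) := by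
  have h1 : 0 < u - s := by linarith [hu.1]
  have h2 : 0 < t - u := by linarith [hu.2]
  rw [Real.rpow_neg (bridgeVar_pos hu).le, Real.rpow_neg h1.le, Real.rpow_neg h2.le,
    ← Real.inv_rpow (bridgeVar_pos hu).le, ← Real.inv_rpow h1.le, ← Real.inv_rpow h2.le,
    inv_bridgeVar hu]
  exact Real.rpow_add_le_add_rpow (by positivity) (by positivity) hp hp1

lemma intervalIntegrable_rpow_add {s t p : ℝ} (hp : p < 1) :
    IntervalIntegrable (fun u => (u - s) ^ (-p) + (t - u) ^ (-p)) volume s t := by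
  have h : IntervalIntegrable (fun u : ℝ => u ^ (-p)) volume 0 (t - s) :=
    intervalIntegral.intervalIntegrable_rpow' (by linarith)
  have h1 := h.comp_sub_right s
  have h2 := (h.comp_sub_left t).symm
  simp only [zero_add, sub_add_cancel, sub_sub_cancel, sub_zero] at h1 h2
  exact h1.add h2

lemma integral_rpow_add {s t p : ℝ} (hp : p < 1) :
    ∫ u in s..t, ((u - s) ^ (-p) + (t - u) ^ (-p)) = 2 * (t - s) ^ (1 - p) / (1 - p) := by
  have h : IntervalIntegrable (fun u : ℝ => u ^ (-p)) volume 0 (t - s) :=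
    intervalIntegral.intervalIntegrable_rpow' (by linarith)
  have h1 := h.comp_sub_right s
  have h2 := (h.comp_sub_left t).symm
  simp only [zero_add, sub_add_cancel, sub_sub_cancel, sub_zero] at h1 h2
  rw [intervalIntegral.integral_add h1 h2,
    intervalIntegral.integral_comp_sub_right (fun u => u ^ (-p)),
    intervalIntegral.integral_comp_sub_left (fun u => u ^ (-p)), sub_self, sub_self,
    integral_rpow (Or.inl (by linarith)), show -p + 1 = 1 - p by ring,
    Real.zero_rpow (by linarith)]
  ring

lemma spreadDeriv_sq_le {s t u : ℝ} (hu : u ∈ Ioo s t) :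
    spreadDeriv s t u ^ 2 ≤ (u - s) ^ (-(1 / 2) : ℝ) + (t - u) ^ (-(1 / 2) : ℝ) := by
  have hst : 0 < t - s := by linarith [hu.1, hu.2]
  have hb := bridgeVar_pos hu
  refine le_trans ?_ (rpow_bridgeVar_le hu (by norm_num) (by norm_num))
  have h1 : ((t + s - 2 * u) / (t - s)) ^ 2 ≤ 1 := by
    rw [div_pow, div_le_one (by positivity)]
    nlinarith [mul_pos (sub_pos.2 hu.1) (sub_pos.2 hu.2)]
  have h2 : (bridgeVar s t u ^ (-(1 / 4) : ℝ)) ^ 2 = bridgeVar s t u ^ (-(1 / 2) : ℝ) := by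
    rw [← Real.rpow_natCast, ← Real.rpow_mul hb.le]
    norm_num
  rw [spreadDeriv, mul_pow, mul_pow, h2]
  have h3 : 0 ≤ bridgeVar s t u ^ (-(1 / 2) : ℝ) := Real.rpow_nonneg hb.le _
  nlinarith [mul_nonneg (sub_nonneg.2 h1) h3]

lemma ae_mem_Ioo {s t : ℝ} : ∀ᵐ u ∂(volume.restrict (Ioc s t)), u ∈ Ioo s t := by
  filter_upwards [ae_restrict_mem measurableSet_Ioc, ae_restrict_of_ae (ae_ne_point t)] with u h1 h2
  exact ⟨h1.1, lt_of_le_of_ne h1.2 h2⟩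

lemma memLp_spreadDeriv {s t : ℝ} (hst : s ≤ t) :
    MemLp (spreadDeriv s t) 2 (volume.restrict (Ioc s t)) := by
  rw [memLp_two_iff_integrable_sq (measurable_spreadDeriv s t).aestronglyMeasurable]
  refine Integrable.mono' ((intervalIntegrable_iff_integrableOn_Ioc_of_le hst).1
    (intervalIntegrable_rpow_add (p := 1 / 2) (by norm_num)))
    ((measurable_spreadDeriv s t).pow_const 2).aestronglyMeasurable ?_
  filter_upwards [ae_mem_Ioo] with u hu
  rw [Real.norm_of_nonneg (sq_nonneg _)]
  exact spreadDeriv_sq_le hu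

/-- The two endpoint singularities integrate to `4 (t-s)^{1/2}`, and `√2 ≤ 3/2`. The bound is
uniform in `s` and `t`, as the final infimum requires. -/
lemma integral_spreadDeriv_sq_le {s t : ℝ} (hst : s ≤ t) (hts : t - s ≤ 2) :
    ∫ u in s..t, spreadDeriv s t u ^ 2 ≤ 6 := by
  have h1 : ∫ u in s..t, spreadDeriv s t u ^ 2
      ≤ ∫ u in s..t, ((u - s) ^ (-(1 / 2) : ℝ) + (t - u) ^ (-(1 / 2) : ℝ)) := by
    refine intervalIntegral.integral_mono_ae_restrict hst
      ((intervalIntegrable_iff_integrableOn_Ioc_of_le hst).2 (memLp_spreadDeriv hst).integrable_sq)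
      (intervalIntegrable_rpow_add (by norm_num)) ?_
    rw [← restrict_Ioc_eq_restrict_Icc]
    filter_upwards [ae_mem_Ioo] with u hu
    exact spreadDeriv_sq_le hu
  rw [integral_rpow_add (by norm_num)] at h1
  have h2 : (t - s) ^ (1 - 1 / 2 : ℝ) ≤ 3 / 2 := by
    rw [show (1 - 1 / 2 : ℝ) = 1 / 2 by norm_num, ← Real.sqrt_eq_rpow]
    refine (Real.sqrt_le_left (by norm_num)).2 ?_
    linarith
  refine h1.trans ?_
  rw [div_le_iff₀ (by norm_num)]
  linarith

lemma integral_spreadDeriv {s t u : ℝ} (hu : u ∈ Icc s t) :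
    ∫ w in s..u, spreadDeriv s t w = spread s t u := by
  have hst := hu.1.trans hu.2
  have hi : IntervalIntegrable (spreadDeriv s t) volume s u := by
    refine IntervalIntegrable.mono_set (a := s) (b := t)
      ((intervalIntegrable_iff_integrableOn_Ioc_of_le hst).2
      (memLp_one_iff_integrable.1 ((memLp_spreadDeriv hst).mono_exponent (by norm_num)))) ?_
    rw [uIcc_of_le hu.1, uIcc_of_le hst]
    exact Icc_subset_Icc_right hu.2
  rw [intervalIntegral.integral_eq_sub_of_hasDerivAt_of_le hu.1
    (continuous_spread s t).continuousOn
    (fun w hw => hasDerivAt_spread ⟨hw.1, hw.2.trans_le hu.2⟩) hi, spread_left, sub_zero]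

/-- Here `1/b^{3/4}` is dominated by endpoint powers with integral `8 (t-s)^{1/4}`. -/
lemma lintegral_inv_spread_le {s t : ℝ} (hst : s ≤ t) (hts : t - s ≤ 2) :
    ∫⁻ u in Ioc s t, ENNReal.ofReal (spread s t u)⁻¹ ≤ ENNReal.ofReal 16 := by
  have hi : IntegrableOn (fun u => (u - s) ^ (-(3 / 4) : ℝ) + (t - u) ^ (-(3 / 4) : ℝ)) (Ioc s t) :=
    (intervalIntegrable_iff_integrableOn_Ioc_of_le hst).1
      (intervalIntegrable_rpow_add (by norm_num))
  calc ∫⁻ u in Ioc s t, ENNReal.ofReal (spread s t u)⁻¹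
      ≤ ∫⁻ u in Ioc s t, ENNReal.ofReal ((u - s) ^ (-(3 / 4) : ℝ) + (t - u) ^ (-(3 / 4) : ℝ)) := by
        refine lintegral_mono_ae ?_
        filter_upwards [ae_mem_Ioo] with u hu
        refine ENNReal.ofReal_le_ofReal ?_
        rw [spread, ← Real.rpow_neg (bridgeVar_pos hu).le]
        exact rpow_bridgeVar_le hu (by norm_num) (by norm_num)
    _ = ENNReal.ofReal (∫ u in s..t, ((u - s) ^ (-(3 / 4) : ℝ) + (t - u) ^ (-(3 / 4) : ℝ))) := by
        rw [intervalIntegral.integral_of_le hst, ofReal_integral_eq_lintegral_ofReal hi]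
        filter_upwards [ae_restrict_mem measurableSet_Ioc] with u hu
        have h1 : 0 ≤ u - s := by linarith [hu.1]
        have h2 : 0 ≤ t - u := by linarith [hu.2]
        simp only [Pi.zero_apply]
        positivity
    _ ≤ ENNReal.ofReal 16 := by
        refine ENNReal.ofReal_le_ofReal ?_
        rw [integral_rpow_add (by norm_num)]
        have h3 : (t - s) ^ (1 - 3 / 4 : ℝ) ≤ 2 := by
          calc (t - s) ^ (1 - 3 / 4 : ℝ) ≤ 2 ^ (1 - 3 / 4 : ℝ) :=
                Real.rpow_le_rpow (by linarith) hts (by norm_num)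
            _ ≤ 2 ^ (1 : ℝ) := Real.rpow_le_rpow_of_exponent_le (by norm_num) (by norm_num)
            _ = 2 := Real.rpow_one 2
        rw [div_le_iff₀ (by norm_num)]
        linarith

lemma spread_sq_le {s t u : ℝ} (hu : u ∈ Icc s t) (hts : t - s ≤ 2) : spread s t u ^ 2 ≤ 4 := by
  have hb := bridgeVar_nonneg hu
  have h1 : spread s t u ≤ 2 := by
    calc bridgeVar s t u ^ (3 / 4 : ℝ) ≤ 2 ^ (3 / 4 : ℝ) :=
          Real.rpow_le_rpow hb ((bridgeVar_le hu).trans hts) (by norm_num)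
      _ ≤ 2 ^ (1 : ℝ) := Real.rpow_le_rpow_of_exponent_le (by norm_num) (by norm_num)
      _ = 2 := Real.rpow_one 2
  have h0 : 0 ≤ spread s t u := Real.rpow_nonneg hb _
  nlinarith

end LowerTail

/-! ### Averaging over nearby paths and the quantitative estimate. -/

namespace LowerTail

variable {Ω : Type*} [MeasurableSpace Ω] {P : Measure Ω} {B : ℝ≥0 → Ω → ℝ}

/-- The variance obtained when paths are spread out at scale `δ`. -/
noncomputable def spreadVar (lam δ s t u : ℝ) : ℝ≥0 :=
  (bridgeVar s t u / lam).toNNReal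
    + NNReal.mk (spread s t u ^ 2) (sq_nonneg _) * NNReal.mk (δ ^ 2) (sq_nonneg _)

lemma measurable_lintegral_gaussianReal {ρ : ℝ × ℝ → ℝ} (hρ : Measurable ρ) {γ c : ℝ → ℝ}
    (hγ : Measurable γ) (hc : Measurable c) (lam s t : ℝ) :
    Measurable fun q : ℝ × ℝ => ∫⁻ z, ‖ρ (q.2, z) - c q.2‖ₑ
      ∂(gaussianReal (γ q.2 + q.1 * spread s t q.2) (bridgeVar s t q.2 / lam).toNNReal) := by
  have hb := (continuous_bridgeVar s t).measurable
  have hs := (continuous_spread s t).measurable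
  have h1 : ∀ q : ℝ × ℝ, ∫⁻ z, ‖ρ (q.2, z) - c q.2‖ₑ
      ∂(gaussianReal (γ q.2 + q.1 * spread s t q.2) (bridgeVar s t q.2 / lam).toNNReal)
      = ∫⁻ w, ‖ρ (q.2, (γ q.2 + q.1 * spread s t q.2)
        + √((bridgeVar s t q.2 / lam).toNNReal : ℝ) * w) - c q.2‖ₑ ∂(gaussianReal 0 1) := by
    intro q
    exact lintegral_gaussianReal ((hρ.comp measurable_prodMk_left).sub_const _).enorm _ _
  simp only [h1]
  refine Measurable.lintegral_prod_right' (f := fun x : (ℝ × ℝ) × ℝ =>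
    ‖ρ (x.1.2, (γ x.1.2 + x.1.1 * spread s t x.1.2)
        + √((bridgeVar s t x.1.2 / lam).toNNReal : ℝ) * x.2) - c x.1.2‖ₑ) ?_
  have h2 : Measurable fun x : (ℝ × ℝ) × ℝ => (x.1.2, (γ x.1.2 + x.1.1 * spread s t x.1.2)
        + √((bridgeVar s t x.1.2 / lam).toNNReal : ℝ) * x.2) := by fun_prop
  exact ((hρ.comp h2).sub (hc.comp (by fun_prop))).enorm

/-- Averaging the lower bound for the Feynman–Kac expectation over a family of nearby paths. -/
lemma ofReal_le_lintegral_of_FK_le (hB : IsBrownianReal B P) {lam s t : ℝ} (hlam : 0 < lam)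
    (hst : s < t) (hts : t - s ≤ 2) {y x : ℝ} {f γ : ℝ → ℝ}
    (hf : MemLp f 2 (volume.restrict (Ioc s t)))
    (hγ : ∀ u ∈ Icc s t, γ u = y + ∫ w in s..u, f w) (hγt : γ t = x) (hγm : Measurable γ)
    {ρ : ℝ × ℝ → ℝ} (hρ : Measurable ρ) {c : ℝ → ℝ} (hcm : Measurable c)
    (hc : IntervalIntegrable c volume s t) (δ : ℝ) {l : ℝ}
    (hl : FK P B lam ρ s y t x ≤ ENNReal.ofReal (Real.exp (lam * l))) :
    ENNReal.ofReal ((∫ u in s..t, c u) - l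
        - ((∫ u in s..t, f u ^ 2) / 2 - (y - x) ^ 2 / (2 * (t - s))) - 3 * δ ^ 2)
      ≤ ∫⁻ u in Ioc s t, ∫⁻ z, ‖ρ (u, z) - c u‖ₑ ∂(gaussianReal (γ u) (spreadVar lam δ s t u)) := by
  set φ := spread s t with hφ
  set E : ℝ → ℝ≥0∞ := fun a => ∫⁻ u in Ioc s t, ∫⁻ z, ‖ρ (u, z) - c u‖ₑ
      ∂(gaussianReal (γ u + a * φ u) (bridgeVar s t u / lam).toNNReal) with hE
  set C := (∫ u in s..t, c u) with hC
  set J := (∫ u in s..t, f u ^ 2) / 2 - (y - x) ^ 2 / (2 * (t - s)) with hJ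
  set j1 := ∫ u in s..t, f u * spreadDeriv s t u with hj1
  set j2 := ∫ u in s..t, spreadDeriv s t u ^ 2 with hj2
  have hsd := memLp_spreadDeriv hst.le
  have hmem : ∀ {g : ℝ → ℝ}, IntegrableOn g (Ioc s t) → IntervalIntegrable g volume s t :=
    fun h => (intervalIntegrable_iff_integrableOn_Ioc_of_le hst.le).2 h
  have hi1 : ∀ {g : ℝ → ℝ}, MemLp g 2 (volume.restrict (Ioc s t)) → IntervalIntegrable g volume s t :=
    fun h => hmem (memLp_one_iff_integrable.1 (h.mono_exponent (by norm_num)))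
  -- This is the single-path bound for `γ + aφ`, which keeps the endpoints because `φ` vanishes
  -- there; `j1` and `j2` come from expanding the kinetic energy.
  have key : ∀ a, ENNReal.ofReal (C - l - J - a * j1 - a ^ 2 * (j2 / 2)) ≤ E a := by
    intro a
    by_cases htop : E a = ∞
    · rw [htop]; exact le_top
    have hfa : MemLp (fun u => f u + a * spreadDeriv s t u) 2 (volume.restrict (Ioc s t)) :=
      hf.add (hsd.const_mul a)
    have hγa : ∀ u ∈ Icc s t, γ u + a * φ u
        = y + ∫ w in s..u, (f w + a * spreadDeriv s t w) := by
      intro u hu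
      have hsub : uIcc s u ⊆ uIcc s t := by
        rw [uIcc_of_le hu.1, uIcc_of_le hst.le]; exact Icc_subset_Icc_right hu.2
      rw [intervalIntegral.integral_add ((hi1 hf).mono_set hsub)
        (((hi1 hsd).mono_set hsub).const_mul a), intervalIntegral.integral_const_mul,
        integral_spreadDeriv hu, hγ u hu]
      ring
    have hγat : γ t + a * φ t = x := by rw [hφ, spread_right, hγt]; ring
    have h1 := (le_FK hB hlam hst hfa hγa hγat hρ hc htop).trans hl
    rw [ENNReal.ofReal_le_ofReal_iff (Real.exp_pos _).le, Real.exp_le_exp,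
      mul_le_mul_iff_right₀ hlam] at h1
    have h2 : ∫ u in s..t, (f u + a * spreadDeriv s t u) ^ 2
        = (∫ u in s..t, f u ^ 2) + 2 * a * j1 + a ^ 2 * j2 := by
      have h3 : ∀ u, (f u + a * spreadDeriv s t u) ^ 2
          = f u ^ 2 + 2 * a * (f u * spreadDeriv s t u) + a ^ 2 * spreadDeriv s t u ^ 2 :=
        fun u => by ring
      have i1 := hmem hf.integrable_sq
      have i2 := hmem hsd.integrable_sq
      have i3 : IntervalIntegrable (fun u => f u * spreadDeriv s t u) volume s t :=
        hmem (hf.integrable_mul hsd)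
      simp only [h3]
      rw [intervalIntegral.integral_add (i1.add (i3.const_mul _)) (i2.const_mul _),
        intervalIntegral.integral_add i1 (i3.const_mul _), intervalIntegral.integral_const_mul,
        intervalIntegral.integral_const_mul]
    rw [h2] at h1
    refine ENNReal.ofReal_le_of_le_toReal ?_
    have h4 : (E a).toReal = (∫⁻ u in Ioc s t, ∫⁻ z, ‖ρ (u, z) - c u‖ₑ
      ∂(gaussianReal (γ u + a * φ u) (bridgeVar s t u / lam).toNNReal)).toReal := rfl
    rw [← h4] at h1
    rw [hJ]
    linarith
  set w : ℝ≥0 := NNReal.mk (δ ^ 2) (sq_nonneg _) with hw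
  have hid : Integrable (fun a : ℝ => a) (gaussianReal 0 w) :=
    memLp_one_iff_integrable.1 (memLp_id_gaussianReal 1)
  have hsq : Integrable (fun a : ℝ => a ^ 2) (gaussianReal 0 w) :=
    (memLp_id_gaussianReal 2).integrable_sq
  have hsqv : ∫ a, a ^ 2 ∂(gaussianReal 0 w) = δ ^ 2 := by
    have h := variance_id_gaussianReal (μ := 0) (v := w)
    rw [variance_eq_sub (memLp_id_gaussianReal 2)] at h
    simpa [integral_id_gaussianReal, hw] using h
  have hidv : ∫ a, a ∂(gaussianReal 0 w) = 0 := integral_id_gaussianReal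
  have hj2le : j2 ≤ 6 := integral_spreadDeriv_sq_le hst.le hts
  have hint : Integrable (fun a => C - l - J - a * j1 - a ^ 2 * (j2 / 2)) (gaussianReal 0 w) :=
    ((integrable_const _).sub (hid.mul_const _)).sub (hsq.mul_const _)
  -- The term `a * j1` has mean zero, so no bound on `j1`, hence none on `γ`, is needed; `j2 ≤ 6`
  -- later gives `3δ²`.
  have hval : ∫ a, (C - l - J - a * j1 - a ^ 2 * (j2 / 2)) ∂(gaussianReal 0 w)
      = C - l - J - δ ^ 2 * (j2 / 2) := by
    have i1 : Integrable (fun a => C - l - J - a * j1) (gaussianReal 0 w) :=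
      (integrable_const _).sub (hid.mul_const _)
    rw [integral_sub i1 (hsq.mul_const _),
      integral_sub (integrable_const _) (hid.mul_const _), integral_const, integral_mul_const,
      integral_mul_const, hidv, hsqv]
    simp
  calc _ ≤ ENNReal.ofReal (∫ a, (C - l - J - a * j1 - a ^ 2 * (j2 / 2)) ∂(gaussianReal 0 w)) := by
        refine ENNReal.ofReal_le_ofReal ?_
        rw [hval]
        nlinarith [sq_nonneg δ]
    _ ≤ ∫⁻ a, ENNReal.ofReal (C - l - J - a * j1 - a ^ 2 * (j2 / 2)) ∂(gaussianReal 0 w) :=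
        ofReal_integral_le_lintegral_ofReal hint
    _ ≤ ∫⁻ a, E a ∂(gaussianReal 0 w) := lintegral_mono key
    _ = ∫⁻ u in Ioc s t, ∫⁻ a, ∫⁻ z, ‖ρ (u, z) - c u‖ₑ
          ∂(gaussianReal (γ u + a * φ u) (bridgeVar s t u / lam).toNNReal) ∂(gaussianReal 0 w) :=
        lintegral_lintegral_swap
          (measurable_lintegral_gaussianReal hρ hγm hcm lam s t).aemeasurable
    _ = _ := by
        refine lintegral_congr fun u => ?_
        exact lintegral_lintegral_gaussianReal
          ((hρ.comp measurable_prodMk_left).sub_const _).enorm _ _ _ _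

lemma lintegral_strip_le {s t : ℝ} (hs : 0 ≤ s) (ht : t ≤ 2) {g : ℝ × ℝ → ℝ≥0∞}
    (hg : Measurable g) :
    ∫⁻ u in Ioc s t, ∫⁻ z, g (u, z) ≤ ∫⁻ p, g p ∂stripMeasure := by
  have hsub : Ioc s t ⊆ Icc 0 2 := fun u hu => ⟨hs.trans hu.1.le, hu.2.trans ht⟩
  rw [stripMeasure, Measure.volume_eq_prod, ← Measure.prod_restrict, Measure.restrict_univ,
    lintegral_prod _ hg.aemeasurable]
  exact lintegral_mono_set hsub

/-- The quantitative form of the lower bound along an `H¹` path. -/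
lemma ofReal_le_of_FK_le (hB : IsBrownianReal B P) {lam s t : ℝ} (hlam : 0 < lam)
    (hs : 0 ≤ s) (hst : s < t) (ht : t ≤ 2) {y x : ℝ} {γ : ℝ → ℝ} (hγ : IsH1Path s y t x γ)
    {ρ : ℝ × ℝ → ℝ} (hρ : AEStronglyMeasurable ρ stripMeasure) {δ k : ℝ} (hδ : 0 < δ) (hk : 0 < k)
    {l : ℝ} (hl : FK P B lam ρ s y t x ≤ ENNReal.ofReal (Real.exp (lam * l))) :
    ENNReal.ofReal (-(∫ u in s..t, (1 / 2 * deriv γ u ^ 2 - rhoLim (u, γ u)))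
        + (y - x) ^ 2 / (2 * (t - s)) - l - 3 * δ ^ 2)
      ≤ ENNReal.ofReal k * eLpNorm (fun p => ρ p - rhoLim p) 2 stripMeasure ^ 2
        + ENNReal.ofReal (16 * (k⁻¹ * δ⁻¹)) + modulus √(2 / lam + 4 * δ ^ 2) := by
  have hts : t - s ≤ 2 := by linarith
  -- `ρ` need only be a.e. measurable; a Borel version has the same Feynman–Kac expectation by
  -- `FK_congr_ae`.
  set ρ' := hρ.mk ρ with hρ'
  have hρm : Measurable ρ' := hρ.stronglyMeasurable_mk.measurable
  have hl' : FK P B lam ρ' s y t x ≤ ENNReal.ofReal (Real.exp (lam * l)) := by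
    rwa [← FK_congr_ae hB hlam hs hst ht y x hρ.ae_eq_mk]
  set η := √(2 / lam + 4 * δ ^ 2) with hη
  have hγc : ContinuousOn γ (Icc s t) := by
    have := hγ.absolutelyContinuous.continuousOn
    rwa [uIcc_of_le hst.le] at this
  -- The path is arbitrary outside `[s,t]`; cutting it off makes it Borel on the line.
  set γ' := (Icc s t).indicator γ with hγ'
  have hγm : Measurable γ' := by
    have := hγc.measurable_piecewise (g := fun _ => (0 : ℝ)) continuousOn_const measurableSet_Icc
    rwa [show (fun _ : ℝ => (0 : ℝ)) = 0 from rfl, piecewise_eq_indicator] at this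
  have hγe : ∀ u ∈ Icc s t, γ' u = γ u := fun u hu => indicator_of_mem hu γ
  set c : ℝ → ℝ := fun u => rhoLim (u, γ' u) with hc
  have hcm : Measurable c := measurable_rhoLim.comp (measurable_id.prodMk hγm)
  have hci : IntervalIntegrable c volume s t :=
    intervalIntegrable_rhoLim hst.le (hγc.congr hγe)
  have hf : MemLp (deriv γ) 2 (volume.restrict (Ioc s t)) := by
    rw [memLp_two_iff_integrable_sq (measurable_deriv γ).aestronglyMeasurable]
    exact (intervalIntegrable_iff_integrableOn_Ioc_of_le hst.le).1 hγ.sq_integrable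
  have hγf : ∀ u ∈ Icc s t, γ' u = y + ∫ w in s..u, deriv γ w := by
    intro u hu
    rw [hγe u hu, (hγ.mono le_rfl hu.1 hu.2).absolutelyContinuous.integral_deriv_eq_sub, hγ.left]
    ring
  have hγt : γ' t = x := by rw [hγe t ⟨hst.le, le_rfl⟩, hγ.right]
  have h1 := ofReal_le_lintegral_of_FK_le hB hlam hst hts hf hγf hγt hγm hρm hcm hci δ hl'
  have hval : ∫ u in s..t, (1 / 2 * deriv γ u ^ 2 - rhoLim (u, γ u))
      = (∫ u in s..t, deriv γ u ^ 2) / 2 - ∫ u in s..t, c u := by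
    have hce : ∫ u in s..t, rhoLim (u, γ u) = ∫ u in s..t, c u := by
      refine intervalIntegral.integral_congr fun u hu => ?_
      rw [uIcc_of_le hst.le] at hu
      simp only [hc, hγe u hu]
    rw [intervalIntegral.integral_sub (hγ.sq_integrable.const_mul _)
      (intervalIntegrable_rhoLim hst.le hγc), intervalIntegral.integral_const_mul, hce]
    ring
  have hle : -(∫ u in s..t, (1 / 2 * deriv γ u ^ 2 - rhoLim (u, γ u)))
        + (y - x) ^ 2 / (2 * (t - s)) - l - 3 * δ ^ 2
      = (∫ u in s..t, c u) - l
        - ((∫ u in s..t, deriv γ u ^ 2) / 2 - (y - x) ^ 2 / (2 * (t - s))) - 3 * δ ^ 2 := by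
    rw [hval]; ring
  rw [hle]
  refine h1.trans ?_
  set D : ℝ × ℝ → ℝ := fun p => ρ' p - rhoLim p with hD
  have hDm : Measurable D := hρm.sub measurable_rhoLim
  have hD2 : ∫⁻ p, ‖D p‖ₑ ^ 2 ∂stripMeasure
      = eLpNorm (fun p => ρ p - rhoLim p) 2 stripMeasure ^ 2 := by
    have h2 : eLpNorm (fun p => ρ p - rhoLim p) 2 stripMeasure = eLpNorm D 2 stripMeasure := by
      refine eLpNorm_congr_ae ?_
      filter_upwards [hρ.ae_eq_mk] with p hp
      simp only [hD, hρ', ← hp]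
    have h3 := eLpNorm_nnreal_pow_eq_lintegral (f := D) (μ := stripMeasure) (p := 2) (by norm_num)
    rw [h2]
    simpa using h3.symm
  have hpt : ∀ᵐ u ∂(volume.restrict (Ioc s t)),
      ∫⁻ z, ‖ρ' (u, z) - c u‖ₑ ∂(gaussianReal (γ' u) (spreadVar lam δ s t u))
        ≤ (ENNReal.ofReal k * (∫⁻ z, ‖D (u, z)‖ₑ ^ 2)
          + ENNReal.ofReal (k⁻¹ * δ⁻¹) * ENNReal.ofReal (spread s t u)⁻¹)
          + (Ioo (0 : ℝ) 2).indicator (fun u => ENNReal.ofReal (min (r u) (r u ^ 2 * η))) u := by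
    filter_upwards [ae_mem_Ioo] with u hu
    have hu2 : u ∈ Ioo (0 : ℝ) 2 := ⟨hs.trans_lt hu.1, hu.2.trans_le ht⟩
    have hu' : u ∈ Icc s t := Ioo_subset_Icc_self hu
    have hDu : Measurable fun z => D (u, z) := hDm.comp measurable_prodMk_left
    have hv : (spreadVar lam δ s t u : ℝ) = bridgeVar s t u / lam + spread s t u ^ 2 * δ ^ 2 := by
      simp [spreadVar, Real.coe_toNNReal _ (div_nonneg (bridgeVar_nonneg hu') hlam.le)]
    have hb0 := div_nonneg (bridgeVar_nonneg hu') hlam.le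
    rw [indicator_of_mem hu2]
    calc _ ≤ ∫⁻ z, (‖D (u, z)‖ₑ + ‖rhoLim (u, z) - rhoLim (u, γ' u)‖ₑ)
            ∂(gaussianReal (γ' u) (spreadVar lam δ s t u)) := by
          refine lintegral_mono fun z => ?_
          have h3 : ρ' (u, z) - c u = D (u, z) + (rhoLim (u, z) - rhoLim (u, γ' u)) := by
            simp only [hD, hc]; ring
          rw [h3]
          exact enorm_add_le _ _
      _ = ∫⁻ z, ‖D (u, z)‖ₑ ∂(gaussianReal (γ' u) (spreadVar lam δ s t u))
          + ∫⁻ z, ‖rhoLim (u, z) - rhoLim (u, γ' u)‖ₑ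
            ∂(gaussianReal (γ' u) (spreadVar lam δ s t u)) :=
          lintegral_add_left hDu.enorm _
      _ ≤ _ := by
          refine add_le_add ?_ ?_
          · have h4 := lintegral_enorm_gaussianReal_le hDu (m := γ' u) (σ := δ * spread s t u)
              (v := spreadVar lam δ s t u) (mul_pos hδ (spread_pos hu)) hk (by rw [hv]; nlinarith)
            have h5 : k⁻¹ * (δ * spread s t u)⁻¹ = k⁻¹ * δ⁻¹ * (spread s t u)⁻¹ := by
              rw [mul_inv]; ring
            rwa [h5, ENNReal.ofReal_mul (by positivity)] at h4
          · refine lintegral_enorm_rhoLim_sub_le hu2 _ (Real.sqrt_le_sqrt ?_)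
            rw [hv]
            have h6 : bridgeVar s t u / lam ≤ 2 / lam := by
              gcongr
              exact (bridgeVar_le hu').trans hts
            have h7 := spread_sq_le hu' hts
            nlinarith [sq_nonneg δ]
  have hm1 : Measurable fun u => ENNReal.ofReal k * ∫⁻ z, ‖D (u, z)‖ₑ ^ 2 :=
    (Measurable.lintegral_prod_right' (f := fun p => ‖D p‖ₑ ^ 2)
      (hDm.enorm.pow_const 2)).const_mul _
  have hm2 : Measurable fun u => ENNReal.ofReal (k⁻¹ * δ⁻¹) * ENNReal.ofReal (spread s t u)⁻¹ :=
    ((continuous_spread s t).measurable.inv.ennreal_ofReal).const_mul _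
  refine (lintegral_mono_ae hpt).trans ?_
  have hm12 : Measurable fun u => ENNReal.ofReal k * (∫⁻ z, ‖D (u, z)‖ₑ ^ 2)
      + ENNReal.ofReal (k⁻¹ * δ⁻¹) * ENNReal.ofReal (spread s t u)⁻¹ := hm1.add hm2
  rw [lintegral_add_left hm12, lintegral_add_left hm1]
  refine add_le_add (add_le_add ?_ ?_) ?_
  · have hm3 : Measurable fun u => ∫⁻ z, ‖D (u, z)‖ₑ ^ 2 :=
      Measurable.lintegral_prod_right' (f := fun p => ‖D p‖ₑ ^ 2) (hDm.enorm.pow_const 2)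
    rw [lintegral_const_mul _ hm3, ← hD2]
    gcongr
    exact lintegral_strip_le hs ht (g := fun p => ‖D p‖ₑ ^ 2) (hDm.enorm.pow_const 2)
  · have hm4 : Measurable fun u => ENNReal.ofReal (spread s t u)⁻¹ :=
      (continuous_spread s t).measurable.inv.ennreal_ofReal
    rw [lintegral_const_mul _ hm4, mul_comm 16,
      ENNReal.ofReal_mul (p := k⁻¹ * δ⁻¹) (by positivity)]
    exact mul_le_mul_right (lintegral_inv_spread_le hst.le hts) _
  · calc _ ≤ ∫⁻ u, (Ioo (0 : ℝ) 2).indicator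
          (fun u => ENNReal.ofReal (min (r u) (r u ^ 2 * η))) u := setLIntegral_le_lintegral _ _
      _ = modulus η := lintegral_indicator measurableSet_Ioo _

end LowerTail

/-! ### Choice of parameters and conclusion. -/

namespace LowerTail

lemma log_ofReal_exp (z : ℝ) : ENNReal.log (ENNReal.ofReal (Real.exp z)) = (z : EReal) := by
  rw [ENNReal.log_ofReal_of_pos (Real.exp_pos z), Real.log_exp]

/-- The uniform exponential lower bound for the Feynman–Kac expectation. -/
lemma eventually_exp_le_FK {Ω : Type*} [MeasurableSpace Ω] {P : Measure Ω} {B : ℝ≥0 → Ω → ℝ}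
    (hB : IsBrownianReal B P) {ρ : ℝ → ℝ × ℝ → ℝ}
    (hρ : ∀ lam : ℝ, 0 < lam → MemLp (ρ lam) 2 stripMeasure)
    (hlim : Tendsto (fun lam : ℝ => eLpNorm (fun p => ρ lam p - rhoLim p) 2 stripMeasure)
      atTop (𝓝 0)) {ε : ℝ} (hε : 0 < ε) :
    ∀ᶠ lam : ℝ in atTop, ∀ s y t x : ℝ, 0 ≤ s → s < t → t ≤ 2 → ∀ γ, IsH1Path s y t x γ →
      ENNReal.ofReal (Real.exp (lam *
        (-(∫ u in s..t, (1 / 2 * deriv γ u ^ 2 - rhoLim (u, γ u)))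
          + (y - x) ^ 2 / (2 * (t - s)) - ε))) ≤ FK P B lam (ρ lam) s y t x := by
  have hε8 : (0 : ℝ≥0∞) < ENNReal.ofReal (ε / 8) := ENNReal.ofReal_pos.2 (by positivity)
  obtain ⟨η₀, hη₀, hmod⟩ : ∃ η₀ > 0, ∀ η ∈ Ioo (0 : ℝ) η₀, modulus η < ENNReal.ofReal (ε / 8) := by
    have h := tendsto_modulus.eventually (gt_mem_nhds hε8)
    obtain ⟨η₀, h1, h2⟩ := (mem_nhdsGT_iff_exists_Ioo_subset).1 h
    exact ⟨η₀, h1, fun η hη => h2 hη⟩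
  -- The last two bounds give `3δ² ≤ ε/2`. For `λ ≥ 2/δ²` one has `√(2/λ + 4δ²) ≤ 3δ < η₀`, and `k`
  -- below is chosen so that `16/(kδ) = ε/8`.
  set δ := min (η₀ / 4) (min 1 (ε / 6)) with hδ
  have hδ0 : 0 < δ := by positivity
  have hδ1 : δ ≤ η₀ / 4 := min_le_left _ _
  have hδ2 : δ ≤ 1 := (min_le_right _ _).trans (min_le_left _ _)
  have hδ3 : δ ≤ ε / 6 := (min_le_right _ _).trans (min_le_right _ _)
  set k := 128 / (ε * δ) with hk
  have hk0 : 0 < k := by positivity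
  have hlim2 : Tendsto (fun lam : ℝ => ENNReal.ofReal k *
      eLpNorm (fun p => ρ lam p - rhoLim p) 2 stripMeasure ^ 2) atTop (𝓝 0) := by
    have h := ENNReal.Tendsto.const_mul (a := ENNReal.ofReal k) (ENNReal.Tendsto.pow (n := 2) hlim)
      (Or.inr ENNReal.ofReal_ne_top)
    simpa using h
  filter_upwards [hlim2.eventually (gt_mem_nhds hε8), eventually_gt_atTop 0,
    eventually_ge_atTop (2 / δ ^ 2)] with lam h1 hlam h2 s y t x hs hst ht γ hγ
  by_contra hcon
  -- If the bound fails, the estimate applies with `l` equal to the target exponent minus `ε`. Its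
  -- left side is `ε - 3δ² ≥ ε/2` and its right side at most `3ε/8`.
  have h3 := ofReal_le_of_FK_le hB hlam hs hst ht hγ (hρ lam hlam).aestronglyMeasurable hδ0 hk0
    (not_le.1 hcon).le
  have h4 : modulus √(2 / lam + 4 * δ ^ 2) ≤ ENNReal.ofReal (ε / 8) := by
    refine (modulus_mono ?_).trans (hmod (3 * δ) ⟨by positivity, by linarith⟩).le
    refine Real.sqrt_le_iff.2 ⟨by positivity, ?_⟩
    have : 2 / lam ≤ δ ^ 2 := by
      rw [div_le_iff₀ (by positivity)] at h2 ⊢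
      linarith
    nlinarith
  have h5 : 16 * (k⁻¹ * δ⁻¹) = ε / 8 := by
    rw [hk]; field_simp; norm_num
  have h6 := h3.trans (add_le_add (add_le_add h1.le le_rfl) h4)
  rw [h5, ← ENNReal.ofReal_add (by positivity) (by positivity), ← ENNReal.ofReal_add (by positivity)
    (by positivity), ENNReal.ofReal_le_ofReal_iff (by positivity)] at h6
  nlinarith

end LowerTail

theorem proposition3p1
    {Ω : Type*} [MeasurableSpace Ω] (P : MeasureTheory.Measure Ω)
    (B : ℝ≥0 → Ω → ℝ) (hB : ProbabilityTheory.IsBrownianReal B P)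
    (ρ : ℝ → ℝ × ℝ → ℝ)
    (hρ : ∀ lam : ℝ, 0 < lam → MemLp (ρ lam) 2 LowerTail.stripMeasure)
    (hlim : Tendsto (fun lam : ℝ => eLpNorm (fun p => ρ lam p - LowerTail.rhoLim p) 2
      LowerTail.stripMeasure) atTop (𝓝 0)) :
    (0 : EReal) ≤ liminf
      (fun lam : ℝ =>
        ⨅ (s : ℝ) (y : ℝ) (t : ℝ) (x : ℝ) (_ : LowerTail.GeodConnected s y t x),
          ((lam⁻¹ : ℝ) : EReal) * ENNReal.log (LowerTail.FK P B lam (ρ lam) s y t x)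
            - (LowerTail.hLim t x - LowerTail.hLim s y
              + (((y - x) ^ 2 / (2 * (t - s)) : ℝ) : EReal)))
      atTop := by
  by_contra hcon
  -- A negative `q` strictly above the liminf is contradicted by the uniform bound with `ε = -q`.
  obtain ⟨q, hq1, hq2⟩ := EReal.lt_iff_exists_real_btwn.1 (not_le.1 hcon)
  refine absurd hq1 (not_lt.2 ?_)
  have hq : 0 < -q := by
    have : q < 0 := by exact_mod_cast hq2
    linarith
  refine le_liminf_of_le (by isBoundedDefault) ?_
  filter_upwards [LowerTail.eventually_exp_le_FK hB hρ hlim hq, eventually_gt_atTop 0]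
    with lam h hlam
  refine le_iInf fun s => le_iInf fun y => le_iInf fun t => le_iInf fun x => le_iInf fun hg => ?_
  obtain ⟨hs, hst, ht, γ, hγ, hdiff⟩ := hg.exists_path
  have h1 := ENNReal.log_monotone (h s y t x hs hst ht γ hγ)
  rw [LowerTail.log_ofReal_exp] at h1
  have h2 := mul_le_mul_of_nonneg_left h1
    (show (0 : EReal) ≤ ((lam⁻¹ : ℝ) : EReal) by exact_mod_cast (inv_pos.2 hlam).le)
  rw [← EReal.coe_mul, inv_mul_cancel_left₀ hlam.ne'] at h2
  -- The difference of the values of `hLim` is a real number here, so the extended subtraction is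
  -- ordinary subtraction.
  rw [hdiff, ← EReal.coe_add]
  refine le_trans ?_ (EReal.sub_le_sub h2 le_rfl)
  rw [← EReal.coe_sub]
  exact EReal.coe_le_coe_iff.2 (by linarith)
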